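/- **Setting.** Let $p^-,p^+:\mathbb{R}\to\mathbb{R}\cup\{\pm\infty\}$ be continuous and $1$-periodic with $p^-<p^+$, and let $\mathbb{A}=\{(q,p)\in\mathbb{R}^2 : p^-(q)<p<p^+(q)\}$. Let $F=(Q,P):\mathbb{A}\to\mathbb{A}$ be an exact symplectic twist map, that is, a ($C^1$-)diffeomorphism such that: - $F(q+m,p)=F(q,p)+(m,0)$ for all $(q,p)\in\mathbb{A}$ and $m\in\mathbb{Z}$; - for every $q$, the map $p\mapsto Q(q,p)$ is a diffeomorphism of the interval $\{p : (q,p)\in\mathbb{A}\}$ onto its image; - for every neighbourhood $V$ of $\mathrm{graph}(p^-)\cup\mathrm{graph}(p^+)$ in $\mathbb{R}^2$ there is another neighbourhood $U$ of it with $F(U\cap\mathbb{A})\subseteq V\cap\mathbb{A}$; - $F$ has a generating function: on the set $\mathcal{D}=\{(q,Q(q,p)) : (q,p)\in\mathbb{A}\}$, which is open and invariant under $(q,Q)\mapsto(q+m,Q+m)$, $m\in\mathbb{Z}$, there is a $C^2$ function $S$ with $S(q+m,Q+m)=S(q,Q)$ for $m\in\mathbb{Z}$ and $P\,dQ-p\,dq=dS(q,Q)$.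 The map $F$ is *positive* (*negative*) if $p\mapsto Q(q,p)$ is strictly increasing (strictly decreasing) for every $q$. An *orbit* of $F$ is a sequence $(q_k,p_k)_{k\in\mathbb{Z}}$ in $\mathbb{A}$ with $F(q_k,p_k)=(q_{k+1},p_{k+1})$ for all $k$. It *has no conjugate points* if $\partial_p(\pi_q\circ F^{\ell-k})(q_k,p_k)\neq0$ for all $k\neq\ell$ in $\mathbb{Z}$, where $\pi_q(q,p)=q$. A sequence $(q_k)_{k\in\mathbb{Z}}$ is a *stationary configuration* if $(q_k,q_{k+1})\in\mathcal{D}$ and $\partial_2S(q_{k-1},q_k)+\partial_1S(q_k,q_{k+1})=0$ for all $k$. It is *minimal* (*maximal*) if moreover, for all integers $u\le v$, the segment $(q_k)_{u\le k\le v}$ minimizes (maximizes) $\sum_{k=u}^{v-1}S(x_k,x_{k+1})$ among all real families $(x_k)_{u\le k\le v}$ with $x_u=q_u$, $x_v=q_v$ and $(x_k,x_{k+1})\in\mathcal{D}$ for $u\le k<v$. For coprime $m\in\mathbb{Z}$ and $n\in\mathbb{N}^*$, an *$(m,n)$-periodic Lipschitz graph* of $F$ is the graph $\Gamma\subset\mathbb{A}$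 of a $1$-periodic Lipschitz function $\gamma:\mathbb{R}\to\mathbb{R}$ such that $F^n(q,\gamma(q))=(q+m,\gamma(q))$ for every $q\in\mathbb{R}$. **Proposition.** Let $F$ be an exact symplectic twist map and let $\Gamma=\mathrm{graph}(\gamma)$ be an $(m,n)$-periodic Lipschitz graph of $F$, where $m\in\mathbb{Z}$ and $n\in\mathbb{N}^*$ are coprime. Then: 1. $\Gamma$ is invariant: $F(\Gamma)\subseteq\Gamma$. 2. For every generating function $S$ of $F$, every orbit of $F$ meeting $\Gamma$ projects under $\pi_q$ to a minimal configuration if $F$ is positive, and to a maximal one if $F$ is negative. In both cases the orbit has no conjugate points. 3. $\Gamma$ is as smooth as $F$: if $F$ is $C^r$ on $\mathbb{A}$, with $r\in\mathbb{N}\cup\{\infty\}$, then $\gamma$ is $C^r$; if $F$ is real-analytic on $\mathbb{A}$, then $\gamma$ is real-analytic. 4. $F$ has no other $(m,n)$-periodic Lipschitz graph. -/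

import Mathlib

open Set Topology

namespace TwistMap

/-- The strip `{(q, p) | p⁻(q) < p < p⁺(q)}`; the functions `p⁻`, `p⁺` may take infinite values.
Points of the plane are written `(q, p)`. -/
def strip (pm pp : ℝ → EReal) : Set (ℝ × ℝ) :=
  {z | pm z.1 < (z.2 : EReal) ∧ (z.2 : EReal) < pp z.1}

/-- The fibre over `q` of a subset of the plane. -/
def fibre (A : Set (ℝ × ℝ)) (q : ℝ) : Set ℝ := {p | (q, p) ∈ A}

/-- The graph of `γ : ℝ → ℝ` in the plane. -/
def graph (γ : ℝ → ℝ) : Set (ℝ × ℝ) := {z | z.2 = γ z.1}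

/-- The part lying in the plane of the graph of a function with values in `ℝ ∪ {±∞}`. -/
def egraph (g : ℝ → EReal) : Set (ℝ × ℝ) := {z | (z.2 : EReal) = g z.1}

/-- The boundary data of a strip: two continuous `1`-periodic functions `p⁻ < p⁺`. -/
structure IsStripBoundary (pm pp : ℝ → EReal) : Prop where
  continuous_lower : Continuous pm
  continuous_upper : Continuous pp
  periodic_lower : Function.Periodic pm 1
  periodic_upper : Function.Periodic pp 1
  lower_lt_upper : ∀ q, pm q < pp q

/-- The set of pairs `(q, Q(q, p))` for `(q, p) ∈ A`, where `F(q, p) = (Q(q, p), P(q, p))`. -/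
def genDomain (A : Set (ℝ × ℝ)) (F : ℝ × ℝ → ℝ × ℝ) : Set (ℝ × ℝ) :=
  (fun z : ℝ × ℝ => (z.1, (F z).1)) '' A

/-- `S` is a generating function of `F` on its domain `D = genDomain A F`: it is of class `C²`,
invariant under `(q, Q) ↦ (q + m, Q + m)`, and `dS(q, Q) = P dQ - p dq`. -/
structure IsGeneratingFunction (A : Set (ℝ × ℝ)) (F : ℝ × ℝ → ℝ × ℝ) (S : ℝ × ℝ → ℝ) :
    Prop where
  isOpen_domain : IsOpen (genDomain A F)
  contDiffOn : ContDiffOn ℝ 2 S (genDomain A F)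
  domain_add_int : ∀ q Q : ℝ, ∀ m : ℤ,
    (q, Q) ∈ genDomain A F → (q + m, Q + m) ∈ genDomain A F
  add_int : ∀ q Q : ℝ, ∀ m : ℤ, (q, Q) ∈ genDomain A F → S (q + m, Q + m) = S (q, Q)
  hasFDerivAt : ∀ z ∈ A, HasFDerivAt S
    ((F z).2 • ContinuousLinearMap.snd ℝ ℝ ℝ - z.2 • ContinuousLinearMap.fst ℝ ℝ ℝ)
    (z.1, (F z).1)

/-- Exact symplectic twist maps of the strip bounded by `p⁻` and `p⁺`. The map is a
`C¹`-diffeomorphism of the strip onto itself. -/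
structure IsExactSymplecticTwistMap (pm pp : ℝ → EReal)
    (F : OpenPartialHomeomorph (ℝ × ℝ) (ℝ × ℝ)) : Prop where
  boundary : IsStripBoundary pm pp
  source_eq : F.source = strip pm pp
  target_eq : F.target = strip pm pp
  contDiffOn : ContDiffOn ℝ 1 F (strip pm pp)
  contDiffOn_symm : ContDiffOn ℝ 1 F.symm (strip pm pp)
  /-- periodicity -/
  map_add_int : ∀ q p : ℝ, ∀ m : ℤ, (q, p) ∈ strip pm pp →
    F (q + m, p) = F (q, p) + ((m : ℝ), 0)
  /-- twist condition: `p ↦ Q(q, p)` is a diffeomorphism of the fibre onto its image -/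
  twist_injOn : ∀ q : ℝ, InjOn (fun p => (F (q, p)).1) (fibre (strip pm pp) q)
  twist_deriv_ne_zero : ∀ q : ℝ, ∀ p ∈ fibre (strip pm pp) q,
    deriv (fun p => (F (q, p)).1) p ≠ 0
  /-- boundary preservation -/
  boundary_preservation : ∀ V ∈ 𝓝ˢ (egraph pm ∪ egraph pp), ∃ U ∈ 𝓝ˢ (egraph pm ∪ egraph pp),
    F '' (U ∩ strip pm pp) ⊆ V ∩ strip pm pp
  /-- existence of a generating function -/
  exists_generatingFunction : ∃ S : ℝ × ℝ → ℝ, IsGeneratingFunction (strip pm pp) F S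

/-- `F` is a positive twist map: `p ↦ Q(q, p)` is strictly increasing for every `q`. -/
def IsPositive (A : Set (ℝ × ℝ)) (F : ℝ × ℝ → ℝ × ℝ) : Prop :=
  ∀ q : ℝ, StrictMonoOn (fun p => (F (q, p)).1) (fibre A q)

/-- `F` is a negative twist map: `p ↦ Q(q, p)` is strictly decreasing for every `q`. -/
def IsNegative (A : Set (ℝ × ℝ)) (F : ℝ × ℝ → ℝ × ℝ) : Prop :=
  ∀ q : ℝ, StrictAntiOn (fun p => (F (q, p)).1) (fibre A q)

/-- The graph of `γ` is an `(m, n)`-periodic Lipschitz graph of `F` in `A`. -/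
structure IsPeriodicLipschitzGraph (A : Set (ℝ × ℝ)) (F : ℝ × ℝ → ℝ × ℝ) (m : ℤ) (n : ℕ)
    (γ : ℝ → ℝ) : Prop where
  lipschitz : ∃ K : NNReal, LipschitzWith K γ
  periodic : Function.Periodic γ 1
  graph_subset : graph γ ⊆ A
  iterate_eq : ∀ q : ℝ, F^[n] (q, γ q) = (q + m, γ q)

/-- A (two-sided, infinite) orbit of `F` in `A`. -/
def IsOrbit (A : Set (ℝ × ℝ)) (F : ℝ × ℝ → ℝ × ℝ) (z : ℤ → ℝ × ℝ) : Prop :=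
  ∀ k : ℤ, z k ∈ A ∧ F (z k) = z (k + 1)

/-- Stationary configurations of `S : D → ℝ`. -/
def IsStationary (D : Set (ℝ × ℝ)) (S : ℝ × ℝ → ℝ) (x : ℤ → ℝ) : Prop :=
  ∀ k : ℤ, (x k, x (k + 1)) ∈ D ∧
    deriv (fun t => S (x (k - 1), t)) (x k) + deriv (fun t => S (t, x (k + 1))) (x k) = 0

/-- The action `∑_{k = u}^{v - 1} S(x_k, x_{k+1})`. -/
noncomputable def action (S : ℝ × ℝ → ℝ) (u v : ℤ) (x : ℤ → ℝ) : ℝ :=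
  ∑ k ∈ Finset.Ico u v, S (x k, x (k + 1))

/-- `y` is a competitor of `x` between the times `u` and `v`: it has the same end points, and its
action is defined, i.e. its consecutive pairs belong to the domain `D` of `S`. (Only the values
`y k` for `u ≤ k ≤ v` matter.) -/
def IsCompetitor (D : Set (ℝ × ℝ)) (u v : ℤ) (x y : ℤ → ℝ) : Prop :=
  y u = x u ∧ y v = x v ∧ ∀ k : ℤ, u ≤ k → k < v → (y k, y (k + 1)) ∈ D

/-- Minimal configurations: stationary configurations each of whose finite segments minimizes
the action among all families with the same end points. -/
def IsMinimalConfiguration (D : Set (ℝ × ℝ)) (S : ℝ × ℝ → ℝ) (x : ℤ → ℝ) : Prop :=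
  IsStationary D S x ∧
    ∀ u v : ℤ, u ≤ v → ∀ y : ℤ → ℝ, IsCompetitor D u v x y → action S u v x ≤ action S u v y

/-- Maximal configurations: the counterpart of minimal ones for negative twist maps. -/
def IsMaximalConfiguration (D : Set (ℝ × ℝ)) (S : ℝ × ℝ → ℝ) (x : ℤ → ℝ) : Prop :=
  IsStationary D S x ∧
    ∀ u v : ℤ, u ≤ v → ∀ y : ℤ → ℝ, IsCompetitor D u v x y → action S u v y ≤ action S u v x

/-- Integer iterates `F^j`; negative ones are iterates of the inverse map. -/
def iter (F : OpenPartialHomeomorph (ℝ × ℝ) (ℝ × ℝ)) : ℤ → ℝ × ℝ → ℝ × ℝ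
  | Int.ofNat j => F^[j]
  | Int.negSucc j => F.symm^[j + 1]

/-- The orbit `z` has no conjugate points: `∂_p (π_q ∘ F^{ℓ - k}) (z_k) ≠ 0` for all distinct
`k` and `ℓ`. -/
def HasNoConjugatePoints (F : OpenPartialHomeomorph (ℝ × ℝ) (ℝ × ℝ)) (z : ℤ → ℝ × ℝ) : Prop :=
  ∀ k l : ℤ, k ≠ l → deriv (fun p => (iter F (l - k) ((z k).1, p)).1) (z k).2 ≠ 0

end TwistMap

namespace TwistMap

/-! Let the twist be positive, let `u` be a primitive of `γ`, and write `(q_k, p_k)` for the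
iterates of `(q, γ q)`. Since `dS = P dQ - p dq`, the function `u + orbAction k` of `q` has formal
differential `p_k dq_k`. The image of the graph under `F^k` need not a priori be a graph, so one
compares with its lowest value over each position, in the spirit of the Lax–Oleinik semigroup. Any
chain `x_0, ..., x_k` in the domain costs, together with `u x_0`, at least as much as some orbit of
the graph ending at `x_k` (`exists_orb_le`). At time `n` all these orbits are closed up to
translation and have the same action, so `orbAction_le` bounds below the action of every chain of
length `n`.

Equality forces the initial slope to be `γ` (`eq_of_action_eq`). Applied to a time shift of an orbit
of the graph, this gives invariance; applied to orbits of a second graph, uniqueness. Invariance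
makes `S(x, Q) + u x - u Q` minimal exactly along the graph dynamics (`calibration_le`), whence
minimal configurations. The same inequality keeps the region above the graph invariant, and
quantitative versions show that `∂_p (π_q ∘ F^k)` is positive on the graph for `k ≥ 1`
(`deriv_iterate_pos`). Smoothness then follows from the implicit function theorem, and negative
twists reduce to positive ones by `reflect`. -/

/-- A twist diffeomorphism `F` of `A` with inverse `G` and generating function `S`. -/
structure IsTwist (A : Set (ℝ × ℝ)) (F G : ℝ × ℝ → ℝ × ℝ) (S : ℝ × ℝ → ℝ) : Prop where
  isOpen : IsOpen A
  ordConnected_fibre : ∀ q, (fibre A q).OrdConnected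
  mapsTo : MapsTo F A A
  mapsTo_inv : MapsTo G A A
  left_inv : ∀ z ∈ A, G (F z) = z
  right_inv : ∀ z ∈ A, F (G z) = z
  contDiffOn : ContDiffOn ℝ 1 F A
  contDiffOn_inv : ContDiffOn ℝ 1 G A
  map_add_int : ∀ q p : ℝ, ∀ m : ℤ, (q, p) ∈ A → F (q + m, p) = F (q, p) + ((m : ℝ), 0)
  gen : IsGeneratingFunction A F S
  deriv_ne_zero : ∀ q : ℝ, ∀ p ∈ fibre A q, deriv (fun p => (F (q, p)).1) p ≠ 0

/-- A positive twist diffeomorphism `F` of `A` with inverse `G` and generating function `S`. -/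
structure IsPositiveTwist (A : Set (ℝ × ℝ)) (F G : ℝ × ℝ → ℝ × ℝ) (S : ℝ × ℝ → ℝ) : Prop
    extends IsTwist A F G S where
  positive : IsPositive A F

/-- The `k`-th iterate of the point of the graph of `γ` above `q`. -/
def orb (F : ℝ × ℝ → ℝ × ℝ) (γ : ℝ → ℝ) (k : ℕ) (q : ℝ) : ℝ × ℝ := F^[k] (q, γ q)

/-- The action of the first `k` steps of the orbit starting on the graph of `γ` above `q`. -/
noncomputable def orbAction (F : ℝ × ℝ → ℝ × ℝ) (S : ℝ × ℝ → ℝ) (γ : ℝ → ℝ) (k : ℕ) (q : ℝ) : ℝ :=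
  ∑ j ∈ Finset.range k, S ((orb F γ j q).1, (orb F γ (j + 1) q).1)

/-! ### Domain of the generating function and iterates of the graph -/

section

variable {A : Set (ℝ × ℝ)} {F G : ℝ × ℝ → ℝ × ℝ} {S : ℝ × ℝ → ℝ} {γ : ℝ → ℝ} {m : ℤ} {n : ℕ}

theorem mk_mem_genDomain {z : ℝ × ℝ} (hz : z ∈ A) : (z.1, (F z).1) ∈ genDomain A F :=
  mem_image_of_mem _ hz

theorem exists_of_mem_genDomain {q Q : ℝ} (h : (q, Q) ∈ genDomain A F) :
    ∃ p, (q, p) ∈ A ∧ (F (q, p)).1 = Q := by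
  obtain ⟨⟨q', p⟩, hz, he⟩ := h
  simp only [Prod.mk.injEq] at he
  obtain ⟨rfl, rfl⟩ := he
  exact ⟨p, hz, rfl⟩

theorem IsGeneratingFunction.hasDerivAt_fst (hS : IsGeneratingFunction A F S) {z : ℝ × ℝ}
    (hz : z ∈ A) : HasDerivAt (fun t => S (t, (F z).1)) (-z.2) z.1 := by
  have := (hS.hasFDerivAt z hz).comp_hasDerivAt z.1
    ((hasDerivAt_id z.1).prodMk (hasDerivAt_const z.1 (F z).1))
  simpa [Function.comp_def] using this

theorem IsGeneratingFunction.hasDerivAt_snd (hS : IsGeneratingFunction A F S) {z : ℝ × ℝ}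
    (hz : z ∈ A) : HasDerivAt (fun t => S (z.1, t)) (F z).2 (F z).1 := by
  have := (hS.hasFDerivAt z hz).comp_hasDerivAt (F z).1
    ((hasDerivAt_const (F z).1 z.1).prodMk (hasDerivAt_id (F z).1))
  simpa [Function.comp_def] using this

theorem orb_zero (q : ℝ) : orb F γ 0 q = (q, γ q) := rfl

theorem orb_succ (k : ℕ) (q : ℝ) : orb F γ (k + 1) q = F (orb F γ k q) :=
  Function.iterate_succ_apply' F k _

theorem orbAction_succ (k : ℕ) (q : ℝ) : orbAction F S γ (k + 1) q =
    orbAction F S γ k q + S ((orb F γ k q).1, (orb F γ (k + 1) q).1) :=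
  Finset.sum_range_succ _ _

theorem IsPeriodicLipschitzGraph.continuous (hγ : IsPeriodicLipschitzGraph A F m n γ) :
    Continuous γ := by
  obtain ⟨K, hK⟩ := hγ.lipschitz
  exact hK.continuous

theorem IsPeriodicLipschitzGraph.map_add_int (hγ : IsPeriodicLipschitzGraph A F m n γ)
    (q : ℝ) (k : ℤ) : γ (q + k) = γ q := by
  simpa using hγ.periodic.int_mul k q

theorem IsPeriodicLipschitzGraph.mem (hγ : IsPeriodicLipschitzGraph A F m n γ) (q : ℝ) :
    (q, γ q) ∈ A := hγ.graph_subset rfl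

namespace IsPositiveTwist

variable (h : IsPositiveTwist A F G S) (hγ : IsPeriodicLipschitzGraph A F m n γ)
include h

theorem contDiffAt {z : ℝ × ℝ} (hz : z ∈ A) : ContDiffAt ℝ 1 F z :=
  h.contDiffOn.contDiffAt (h.isOpen.mem_nhds hz)

theorem injOn : InjOn F A := fun x hx y hy hxy => by
  rw [← h.left_inv x hx, hxy, h.left_inv y hy]

theorem fst_lt_iff {q p p' : ℝ} (hp : (q, p) ∈ A) (hp' : (q, p') ∈ A) :
    (F (q, p)).1 < (F (q, p')).1 ↔ p < p' :=
  (h.positive q).lt_iff_lt hp hp'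

theorem iterate_mem (k : ℕ) {z : ℝ × ℝ} (hz : z ∈ A) : F^[k] z ∈ A := h.mapsTo.iterate k hz

theorem iterate_add_int (k : ℕ) {z : ℝ × ℝ} (hz : z ∈ A) (l : ℤ) :
    F^[k] (z + ((l : ℝ), 0)) = F^[k] z + ((l : ℝ), 0) := by
  induction k with
  | zero => rfl
  | succ k ih =>
    rw [Function.iterate_succ_apply', ih, Function.iterate_succ_apply']
    have := h.map_add_int (F^[k] z).1 (F^[k] z).2 l (h.iterate_mem k hz)
    rw [← this]
    congr 1
    ext <;> simp

theorem ordConnected_genDomain_right (q : ℝ) : {Q | (q, Q) ∈ genDomain A F}.OrdConnected := by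
  have : {Q | (q, Q) ∈ genDomain A F} = (fun p => (F (q, p)).1) '' fibre A q := by
    ext Q
    constructor
    · intro hQ
      obtain ⟨p, hp, rfl⟩ := exists_of_mem_genDomain hQ
      exact ⟨p, hp, rfl⟩
    · rintro ⟨p, hp, rfl⟩
      exact mk_mem_genDomain (z := (q, p)) hp
  rw [this]
  apply IsPreconnected.ordConnected
  refine (h.ordConnected_fibre q).isPreconnected.image _ ?_
  exact (continuous_fst.comp_continuousOn h.contDiffOn.continuousOn).comp
    (by fun_prop) (fun p hp => hp)

theorem ordConnected_genDomain_left (Q : ℝ) : {q | (q, Q) ∈ genDomain A F}.OrdConnected := by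
  have : {q | (q, Q) ∈ genDomain A F} = (fun P => (G (Q, P)).1) '' fibre A Q := by
    ext q
    constructor
    · intro hQ
      obtain ⟨p, hp, rfl⟩ := exists_of_mem_genDomain hQ
      exact ⟨(F (q, p)).2, h.mapsTo hp, by simp [h.left_inv _ hp]⟩
    · rintro ⟨P, hP, rfl⟩
      have := mk_mem_genDomain (F := F) (h.mapsTo_inv hP)
      rwa [h.right_inv _ hP] at this
  rw [this]
  apply IsPreconnected.ordConnected
  refine (h.ordConnected_fibre Q).isPreconnected.image _ ?_
  exact (continuous_fst.comp_continuousOn h.contDiffOn_inv.continuousOn).comp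
    (by fun_prop) (fun p hp => hp)

theorem isOpen_genDomain_left (Q : ℝ) : IsOpen {q | (q, Q) ∈ genDomain A F} :=
  h.gen.isOpen_domain.preimage (by fun_prop : Continuous fun q : ℝ => (q, Q))

include hγ

theorem orb_mem (k : ℕ) (q : ℝ) : orb F γ k q ∈ A := h.iterate_mem k (hγ.mem q)

theorem orb_add_int (k : ℕ) (q : ℝ) (l : ℤ) :
    orb F γ k (q + l) = orb F γ k q + ((l : ℝ), 0) := by
  rw [orb, hγ.map_add_int, orb, ← h.iterate_add_int k (hγ.mem q)]
  congr 1
  ext <;> simp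

theorem orb_mem_genDomain (k : ℕ) (q : ℝ) :
    ((orb F γ k q).1, (orb F γ (k + 1) q).1) ∈ genDomain A F := by
  rw [orb_succ]
  exact mk_mem_genDomain (h.orb_mem hγ k q)

theorem continuous_orb (k : ℕ) : Continuous (orb F γ k) := by
  induction k with
  | zero => exact continuous_id.prodMk hγ.continuous
  | succ k ih =>
    have : orb F γ (k + 1) = F ∘ orb F γ k := funext (orb_succ k)
    rw [this]
    exact h.contDiffOn.continuousOn.comp_continuous ih (h.orb_mem hγ k)

/-- Iterates of the graph are only Lipschitz in `q`; this bound replaces the chain rule in the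
first-order expansions of the action. -/
theorem isBigO_orb (k : ℕ) (q : ℝ) :
    (fun x => orb F γ k x - orb F γ k q) =O[𝓝 q] fun x => x - q := by
  induction k with
  | zero =>
    obtain ⟨K, hK⟩ := hγ.lipschitz
    refine Asymptotics.IsBigO.prod_left (f' := fun x => x - q) (g' := fun x => γ x - γ q)
      (Asymptotics.isBigO_refl _ _) ?_
    refine Asymptotics.IsBigO.of_bound K (Filter.Eventually.of_forall fun x => ?_)
    simpa [dist_eq_norm] using hK.dist_le_mul x q
  | succ k ih =>
    simp only [orb_succ]
    have hd := ((h.contDiffAt (h.orb_mem hγ k q)).differentiableAt one_ne_zero).hasFDerivAt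
    exact (hd.isBigO_sub.comp_tendsto ((h.continuous_orb hγ k).tendsto q)).trans ih

theorem continuous_orbAction (k : ℕ) : Continuous (orbAction F S γ k) := by
  refine continuous_finsetSum _ fun j _ => ?_
  exact h.gen.contDiffOn.continuousOn.comp_continuous
    ((continuous_fst.comp (h.continuous_orb hγ j)).prodMk
      (continuous_fst.comp (h.continuous_orb hγ (j + 1)))) (h.orb_mem_genDomain hγ j)

/-! ### Barriers confining the minimization -/

theorem exists_abs_orb_sub_le (k : ℕ) : ∃ M : ℝ, ∀ q, |(orb F γ k q).1 - q| ≤ M := by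
  have hp : Function.Periodic (fun q => (orb F γ k q).1 - q) 1 := fun q => by
    have := h.orb_add_int hγ k q 1
    simp only [Int.cast_one] at this
    simp [this]
  have hc : Continuous (fun q => (orb F γ k q).1 - q) :=
    (continuous_fst.comp (h.continuous_orb hγ k)).sub continuous_id
  obtain ⟨M, hM⟩ := (hp.isBounded_of_continuous one_ne_zero hc).exists_norm_le
  exact ⟨M, fun q => hM _ (mem_range_self q)⟩

theorem isCompact_orb_preimage (k : ℕ) (a b : ℝ) :
    IsCompact {q | (orb F γ k q).1 ∈ Icc a b} := by
  obtain ⟨M, hM⟩ := h.exists_abs_orb_sub_le hγ k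
  refine (isCompact_Icc (a := a - M) (b := b + M)).of_isClosed_subset
    (isClosed_Icc.preimage (continuous_fst.comp (h.continuous_orb hγ k))) fun q hq => ?_
  have := abs_le.1 (hM q)
  exact ⟨by linarith [hq.1], by linarith [hq.2]⟩

/-- The graph dynamics decides on which side `Q` escapes. If the graph point over `a` went to `Q` or
beyond, some graph point at or left of `a` would land on `Q`, and convexity of the slice at height
`Q` would put `(a, Q)` in the domain. So it lands left of `Q`, and convexity of the slice over `a`
puts all images of `a` there. -/
theorem lt_of_notMem_genDomain {a x Q Q' : ℝ} (hx : (x, Q) ∈ genDomain A F) (hax : a < x)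
    (ha : (a, Q) ∉ genDomain A F) (hQ' : (a, Q') ∈ genDomain A F) : Q' < Q := by
  have hc : Continuous fun q => (orb F γ 1 q).1 := continuous_fst.comp (h.continuous_orb hγ 1)
  have hlt : (orb F γ 1 a).1 < Q := by
    by_contra! hle
    obtain ⟨M, hM⟩ := h.exists_abs_orb_sub_le hγ 1
    obtain ⟨q₀, hq₀⟩ : ∃ q₀, q₀ ≤ a ∧ (orb F γ 1 q₀).1 ≤ Q :=
      ⟨min a (Q - M), min_le_left _ _, by
        linarith [(abs_le.1 (hM (min a (Q - M)))).2, min_le_right a (Q - M)]⟩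
    obtain ⟨x', hx', he⟩ := intermediate_value_Icc hq₀.1 hc.continuousOn ⟨hq₀.2, hle⟩
    have hm := h.orb_mem_genDomain hγ 0 x'
    rw [zero_add, show (orb F γ 1 x').1 = Q from he, orb_zero] at hm
    exact ha ((h.ordConnected_genDomain_left Q).out hm hx ⟨hx'.2, hax.le⟩)
  by_contra! hle
  exact ha ((h.ordConnected_genDomain_right a).out (h.orb_mem_genDomain hγ 0 a) hQ' ⟨hlt.le, hle⟩)

theorem gt_of_notMem_genDomain {a x Q Q' : ℝ} (hx : (x, Q) ∈ genDomain A F) (hax : x < a)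
    (ha : (a, Q) ∉ genDomain A F) (hQ' : (a, Q') ∈ genDomain A F) : Q < Q' := by
  have hc : Continuous fun q => (orb F γ 1 q).1 := continuous_fst.comp (h.continuous_orb hγ 1)
  have hlt : Q < (orb F γ 1 a).1 := by
    by_contra! hle
    obtain ⟨M, hM⟩ := h.exists_abs_orb_sub_le hγ 1
    obtain ⟨q₀, hq₀⟩ : ∃ q₀, a ≤ q₀ ∧ Q ≤ (orb F γ 1 q₀).1 :=
      ⟨max a (Q + M), le_max_left _ _, by
        linarith [(abs_le.1 (hM (max a (Q + M)))).1, le_max_right a (Q + M)]⟩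
    obtain ⟨x', hx', he⟩ := intermediate_value_Icc hq₀.1 hc.continuousOn ⟨hle, hq₀.2⟩
    have hm := h.orb_mem_genDomain hγ 0 x'
    rw [zero_add, show (orb F γ 1 x').1 = Q from he, orb_zero] at hm
    exact ha ((h.ordConnected_genDomain_left Q).out hx hm ⟨hax.le, hx'.1⟩)
  by_contra! hle
  exact ha ((h.ordConnected_genDomain_right a).out hQ' (h.orb_mem_genDomain hγ 0 a) ⟨hle, hlt.le⟩)

/-- The infimum of the slice at height `Q` is missing from the open slice, so images from there lie
left of `Q`. Compactness would carry a failure of the claim throughout the slice to that infimum. -/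
theorem exists_left_barrier (k : ℕ) {x Q : ℝ} (hx : (x, Q) ∈ genDomain A F) :
    ∃ a < x, (a, Q) ∈ genDomain A F ∧ ∀ q, (orb F γ k q).1 = a → (orb F γ (k + 1) q).1 < Q := by
  by_contra! hcon
  obtain ⟨M, hM⟩ := h.exists_abs_orb_sub_le hγ k
  obtain ⟨M', hM'⟩ := h.exists_abs_orb_sub_le hγ (k + 1)
  set I := {q | (q, Q) ∈ genDomain A F} with hI
  have hIord : I.OrdConnected := h.ordConnected_genDomain_left Q
  have hbdd : BddBelow I := by
    -- A point `y` below this bound has `q ≤ y + M`, hence a next position at most `y + M + M' < Q`.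
    refine ⟨min x (Q - M - M' - 1), fun y hy => ?_⟩
    by_contra! hlt
    obtain ⟨q, hq, hqQ⟩ := hcon y (hlt.trans_le (min_le_left _ _)) hy
    have := min_le_right x (Q - M - M' - 1)
    linarith [(abs_le.1 (hM q)).1, (abs_le.1 (hM' q)).2]
  have hglb := isGLB_csInf ⟨x, hx⟩ hbdd
  set a := sInf I
  have haI : a ∉ I := fun ha => by
    obtain ⟨ε, hε, hsub⟩ := Metric.isOpen_iff.1 (h.isOpen_genDomain_left Q) a ha
    have : a - ε / 2 ∈ I := hsub (by simp [abs_of_pos hε]; linarith)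
    linarith [hglb.1 this]
  have hax : a < x := lt_of_le_of_ne (hglb.1 hx) fun he => haI (he ▸ hx)
  have hsub : Ioo a x ⊆ I := fun y hy => by
    obtain ⟨z, hz, _, hzy⟩ := hglb.exists_between hy.1
    exact hIord.out hz hx ⟨hzy.le, hy.2.le⟩
  have hf : Continuous fun q => (orb F γ k q).1 := continuous_fst.comp (h.continuous_orb hγ k)
  have hf' : Continuous fun q => (orb F γ (k + 1) q).1 :=
    continuous_fst.comp (h.continuous_orb hγ (k + 1))
  have hK : IsCompact ({q | (orb F γ k q).1 ∈ Icc a x} ∩ {q | Q ≤ (orb F γ (k + 1) q).1}) :=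
    (h.isCompact_orb_preimage hγ k a x).inter_right (isClosed_le continuous_const hf')
  have hcl := (hK.image hf).isClosed
  have hIoo : Ioo a x ⊆ (fun q => (orb F γ k q).1) ''
      ({q | (orb F γ k q).1 ∈ Icc a x} ∩ {q | Q ≤ (orb F γ (k + 1) q).1}) := fun y hy => by
    obtain ⟨q, hq, hqQ⟩ := hcon y hy.2 (hsub hy)
    exact ⟨q, ⟨mem_ofPred.2 (hq ▸ Ioo_subset_Icc_self hy), hqQ⟩, hq⟩
  have ha := hcl.closure_subset_iff.2 hIoo (by
    rw [closure_Ioo hax.ne]; exact left_mem_Icc.2 hax.le)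
  obtain ⟨q, ⟨-, hqQ⟩, hq⟩ := ha
  have hm := h.orb_mem_genDomain hγ k q
  simp only at hq
  rw [hq] at hm
  exact absurd (h.lt_of_notMem_genDomain hγ hx hax haI hm) (not_lt.2 hqQ)

theorem exists_right_barrier (k : ℕ) {x Q : ℝ} (hx : (x, Q) ∈ genDomain A F) :
    ∃ b > x, (b, Q) ∈ genDomain A F ∧ ∀ q, (orb F γ k q).1 = b → Q < (orb F γ (k + 1) q).1 := by
  by_contra! hcon
  obtain ⟨M, hM⟩ := h.exists_abs_orb_sub_le hγ k
  obtain ⟨M', hM'⟩ := h.exists_abs_orb_sub_le hγ (k + 1)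
  set I := {q | (q, Q) ∈ genDomain A F} with hI
  have hIord : I.OrdConnected := h.ordConnected_genDomain_left Q
  have hbdd : BddAbove I := by
    refine ⟨max x (Q + M + M' + 1), fun y hy => ?_⟩
    by_contra! hlt
    obtain ⟨q, hq, hqQ⟩ := hcon y ((le_max_left _ _).trans_lt hlt) hy
    have := le_max_right x (Q + M + M' + 1)
    linarith [(abs_le.1 (hM q)).2, (abs_le.1 (hM' q)).1]
  have hlub := isLUB_csSup ⟨x, hx⟩ hbdd
  set b := sSup I
  have hbI : b ∉ I := fun hb => by
    obtain ⟨ε, hε, hsub⟩ := Metric.isOpen_iff.1 (h.isOpen_genDomain_left Q) b hb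
    have : b + ε / 2 ∈ I := hsub (by simp [abs_of_pos hε]; linarith)
    linarith [hlub.1 this]
  have hxb : x < b := lt_of_le_of_ne (hlub.1 hx) fun he => hbI (he ▸ hx)
  have hsub : Ioo x b ⊆ I := fun y hy => by
    obtain ⟨z, hz, hyz, _⟩ := hlub.exists_between hy.2
    exact hIord.out hx hz ⟨hy.1.le, hyz.le⟩
  have hf : Continuous fun q => (orb F γ k q).1 := continuous_fst.comp (h.continuous_orb hγ k)
  have hf' : Continuous fun q => (orb F γ (k + 1) q).1 :=
    continuous_fst.comp (h.continuous_orb hγ (k + 1))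
  have hK : IsCompact ({q | (orb F γ k q).1 ∈ Icc x b} ∩ {q | (orb F γ (k + 1) q).1 ≤ Q}) :=
    (h.isCompact_orb_preimage hγ k x b).inter_right (isClosed_le hf' continuous_const)
  have hcl := (hK.image hf).isClosed
  have hIoo : Ioo x b ⊆ (fun q => (orb F γ k q).1) ''
      ({q | (orb F γ k q).1 ∈ Icc x b} ∩ {q | (orb F γ (k + 1) q).1 ≤ Q}) := fun y hy => by
    obtain ⟨q, hq, hqQ⟩ := hcon y hy.1 (hsub hy)
    exact ⟨q, ⟨mem_ofPred.2 (hq ▸ Ioo_subset_Icc_self hy), hqQ⟩, hq⟩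
  have hb := hcl.closure_subset_iff.2 hIoo (by
    rw [closure_Ioo hxb.ne]; exact right_mem_Icc.2 hxb.le)
  obtain ⟨q, ⟨-, hqQ⟩, hq⟩ := hb
  have hm := h.orb_mem_genDomain hγ k q
  simp only at hq
  rw [hq] at hm
  exact absurd (h.gt_of_notMem_genDomain hγ hx hxb hbI hm) (not_lt.2 hqQ)

end IsPositiveTwist

end

/-! ### Action comparison, invariance and uniqueness -/

theorem IsPeriodicLipschitzGraph.exists_primitive {A : Set (ℝ × ℝ)} {F : ℝ × ℝ → ℝ × ℝ}
    {γ : ℝ → ℝ} {m : ℤ} {n : ℕ} (hγ : IsPeriodicLipschitzGraph A F m n γ) :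
    ∃ u : ℝ → ℝ, ∀ x, HasDerivAt u (γ x) x :=
  ⟨fun x => ∫ t in (0 : ℝ)..x, γ t, fun x => hγ.continuous.integral_hasStrictDerivAt 0 x
    |>.hasDerivAt⟩

section

variable {A : Set (ℝ × ℝ)} {F G : ℝ × ℝ → ℝ × ℝ} {S : ℝ × ℝ → ℝ} {γ : ℝ → ℝ} {m : ℤ} {n : ℕ}

namespace IsPositiveTwist

variable (h : IsPositiveTwist A F G S) (hγ : IsPeriodicLipschitzGraph A F m n γ)
  {u : ℝ → ℝ} (hu : ∀ x, HasDerivAt u (γ x) x)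
include h hγ

/-- The terms `p_j dq_j` telescope, leaving `p_k dq_k - γ dq`. The expansion keeps the increment of
`q_k` because `q_k` need not be differentiable. -/
theorem isLittleO_orbAction (k : ℕ) (q : ℝ) :
    (fun x => orbAction F S γ k x - orbAction F S γ k q
      - (orb F γ k q).2 * ((orb F γ k x).1 - (orb F γ k q).1) + γ q * (x - q))
      =o[𝓝 q] fun x => x - q := by
  induction k with
  | zero =>
    refine (Asymptotics.isLittleO_zero _ _).congr_left fun x => ?_
    simp [orbAction, orb_zero]
  | succ k ih =>
    have hd := (h.gen.hasFDerivAt _ (h.orb_mem hγ k q)).isLittleO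
    have hk := (continuous_fst.comp (h.continuous_orb hγ k)).tendsto q
    have hk' := (continuous_fst.comp (h.continuous_orb hγ (k + 1))).tendsto q
    rw [← orb_succ (F := F) (γ := γ) k q] at hd
    have ho := hd.comp_tendsto (hk.prodMk_nhds hk')
    have hO : (fun x => ((orb F γ k x).1, (orb F γ (k + 1) x).1) -
        ((orb F γ k q).1, (orb F γ (k + 1) q).1)) =O[𝓝 q] fun x => x - q :=
      Asymptotics.IsBigO.prod_left (f' := fun x => (orb F γ k x).1 - (orb F γ k q).1)
        (g' := fun x => (orb F γ (k + 1) x).1 - (orb F γ (k + 1) q).1)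
        (Asymptotics.isBigO_fst_prod.trans (h.isBigO_orb hγ k q))
        (Asymptotics.isBigO_fst_prod.trans (h.isBigO_orb hγ (k + 1) q))
    refine (ih.add (ho.trans_isBigO hO)).congr_left fun x => ?_
    simp [orbAction_succ]
    ring

theorem orbAction_eq (q q' : ℝ) : orbAction F S γ n q = orbAction F S γ n q' := by
  have hd : ∀ q, HasDerivAt (orbAction F S γ n) 0 q := fun q => by
    rw [hasDerivAt_iff_isLittleO]
    refine (h.isLittleO_orbAction hγ n q).congr_left fun x => ?_
    simp only [orb, hγ.iterate_eq, smul_eq_mul]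
    ring
  exact is_const_of_deriv_eq_zero (fun x => (hd x).differentiableAt) (fun x => (hd x).deriv) q q'

include hu

/-- The fibrewise minimum of `u + orbAction` has a superdifferential: there is a differentiable
function touching it from above. -/
def HasUpperBarrier (F : ℝ × ℝ → ℝ × ℝ) (S : ℝ × ℝ → ℝ) (γ u : ℝ → ℝ) (k : ℕ) : Prop :=
  ∀ q, ∃ B : ℝ → ℝ, HasDerivAt B (orb F γ k q).2 (orb F γ k q).1 ∧
    B (orb F γ k q).1 = u q + orbAction F S γ k q ∧
    ∀ᶠ y in 𝓝 (orb F γ k q).1, ∃ q', (orb F γ k q').1 = y ∧ u q' + orbAction F S γ k q' ≤ B y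

/-- Minimize over all orbits whose `k`-th position lies between two barriers. At a minimizer the
barrier function makes stationarity available, and stationarity says that the momentum `p_k` is the
one sending `q_k` to `Q`: the minimizer is an orbit through time `k + 1`. -/
theorem exists_orb_le_of_hasUpperBarrier {k : ℕ} (hB : HasUpperBarrier F S γ u k) (q₀ Q : ℝ)
    (hQ : ((orb F γ k q₀).1, Q) ∈ genDomain A F) :
    ∃ q, (orb F γ (k + 1) q).1 = Q ∧ u q + orbAction F S γ (k + 1) q ≤
      u q₀ + orbAction F S γ k q₀ + S ((orb F γ k q₀).1, Q) := by
  obtain ⟨a, hax, ha, hka⟩ := h.exists_left_barrier hγ k hQ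
  obtain ⟨b, hxb, hb, hkb⟩ := h.exists_right_barrier hγ k hQ
  have hsub : ∀ y ∈ Icc a b, (y, Q) ∈ genDomain A F := fun y hy =>
    (h.ordConnected_genDomain_left Q).out ha hb hy
  have hf : Continuous fun q => (orb F γ k q).1 := continuous_fst.comp (h.continuous_orb hγ k)
  have huc : Continuous u := continuous_iff_continuousAt.2 fun x => (hu x).continuousAt
  obtain ⟨q, hq, hmin⟩ := (h.isCompact_orb_preimage hγ k a b).exists_isMinOn
    (f := fun q => u q + orbAction F S γ k q + S ((orb F γ k q).1, Q)) ⟨q₀, hax.le, hxb.le⟩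
    ((huc.add (h.continuous_orbAction hγ k)).continuousOn.add
      (h.gen.contDiffOn.continuousOn.comp (hf.prodMk continuous_const).continuousOn
        fun q hq => hsub _ hq))
  obtain ⟨p, hp, hpQ⟩ := exists_of_mem_genDomain (hsub _ hq)
  have hmem : ((orb F γ k q).1, (orb F γ k q).2) ∈ A := h.orb_mem hγ k q
  obtain ⟨B, hBd, hBq, hBy⟩ := hB q
  have hd : HasDerivAt (fun y => B y + S (y, Q)) ((orb F γ k q).2 - p) (orb F γ k q).1 := by
    have := h.gen.hasDerivAt_fst hp
    rw [hpQ] at this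
    exact (hBd.add this).congr_deriv (sub_eq_add_neg _ _).symm
  have hloc : ∀ᶠ y in 𝓝 (orb F γ k q).1, y ∈ Icc a b →
      B (orb F γ k q).1 + S ((orb F γ k q).1, Q) ≤ B y + S (y, Q) := by
    filter_upwards [hBy] with y ⟨q', hq', hle⟩ hy
    have := isMinOn_iff.1 hmin q' (show (orb F γ k q').1 ∈ Icc a b from hq' ▸ hy)
    rw [hq'] at this
    rw [hBq]
    linarith
  have hab : a < b := hax.trans hxb
  have key : (orb F γ k q).2 = p := by
    -- At the left end the barrier and the twist give `p_k < p`, so `B + S(·, Q)` decreases into the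
    -- interval, against minimality; the right end is symmetric.
    rcases eq_or_lt_of_le hq.1 with hqa | hqa
    · exfalso
      have hlt := hka q hqa.symm
      rw [orb_succ, ← hpQ] at hlt
      have hneg : (orb F γ k q).2 < p := (h.fst_lt_iff hmem hp).1 hlt
      have hm : ∀ᶠ y in 𝓝[>] (orb F γ k q).1, 0 ≤
          slope (fun y => B y + S (y, Q)) (orb F γ k q).1 y := by
        filter_upwards [nhdsWithin_le_nhds hloc, self_mem_nhdsWithin,
          nhdsWithin_le_nhds (Iio_mem_nhds (hqa ▸ hab : (orb F γ k q).1 < b))] with y hy hy' hyb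
        rw [slope_def_field]
        exact div_nonneg (sub_nonneg.2 (hy ⟨(hqa ▸ hy').le, le_of_lt hyb⟩)) (sub_pos.2 hy').le
      have := ge_of_tendsto ((hasDerivAt_iff_tendsto_slope.1 hd).mono_left
        (nhdsWithin_mono (s := Ioi (orb F γ k q).1) _ fun y hy => ne_of_gt hy)) hm
      linarith
    · rcases eq_or_lt_of_le hq.2 with hqb | hqb
      · exfalso
        have hlt := hkb q hqb
        rw [orb_succ, ← hpQ] at hlt
        have hneg : p < (orb F γ k q).2 := (h.fst_lt_iff hp hmem).1 hlt
        have hm : ∀ᶠ y in 𝓝[<] (orb F γ k q).1,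
            slope (fun y => B y + S (y, Q)) (orb F γ k q).1 y ≤ 0 := by
          filter_upwards [nhdsWithin_le_nhds hloc, self_mem_nhdsWithin,
            nhdsWithin_le_nhds (Ioi_mem_nhds hqa)] with y hy hy' hyb
          rw [slope_def_field]
          exact div_nonpos_of_nonneg_of_nonpos
            (sub_nonneg.2 (hy ⟨le_of_lt hyb, hqb ▸ (le_of_lt hy')⟩)) (sub_neg.2 hy').le
        have := le_of_tendsto ((hasDerivAt_iff_tendsto_slope.1 hd).mono_left
          (nhdsWithin_mono (s := Iio (orb F γ k q).1) _ fun y hy => ne_of_lt hy)) hm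
        linarith
      · have hlm : IsLocalMin (fun y => B y + S (y, Q)) (orb F γ k q).1 := by
          filter_upwards [hloc, Icc_mem_nhds hqa hqb] with y hy hy' using hy hy'
        exact sub_eq_zero.1 (hlm.hasDerivAt_eq_zero hd)
  have hQq : (orb F γ (k + 1) q).1 = Q := by
    rw [orb_succ, ← hpQ, ← key]
  refine ⟨q, hQq, ?_⟩
  rw [orbAction_succ, hQq, ← add_assoc]
  exact isMinOn_iff.1 hmin q₀ ⟨hax.le, hxb.le⟩

theorem hasUpperBarrier (k : ℕ) : HasUpperBarrier F S γ u k := by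
  induction k with
  | zero =>
    exact fun q => ⟨u, hu q, by simp [orb_zero, orbAction],
      Filter.Eventually.of_forall fun y => ⟨y, rfl, by simp [orbAction]⟩⟩
  | succ k ih =>
    intro q
    have hd := h.gen.hasDerivAt_snd (h.orb_mem hγ k q)
    rw [← orb_succ (F := F) (γ := γ) k q] at hd
    -- Freeze the orbit up to time `k` and move only the last point; the previous lemma provides an
    -- orbit reaching `y` at no greater cost.
    refine ⟨fun y => u q + orbAction F S γ k q + S ((orb F γ k q).1, y), hd.const_add _, ?_, ?_⟩
    · rw [orbAction_succ, ← add_assoc]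
    · have ho : IsOpen {y | ((orb F γ k q).1, y) ∈ genDomain A F} :=
        h.gen.isOpen_domain.preimage (by fun_prop)
      filter_upwards [ho.mem_nhds (h.orb_mem_genDomain hγ k q)] with y hy
      exact h.exists_orb_le_of_hasUpperBarrier hγ hu ih q y hy

theorem exists_orb_le (x : ℕ → ℝ) (k : ℕ) (hx : ∀ j < k, (x j, x (j + 1)) ∈ genDomain A F) :
    ∃ q, (orb F γ k q).1 = x k ∧ u q + orbAction F S γ k q ≤
      u (x 0) + ∑ j ∈ Finset.range k, S (x j, x (j + 1)) := by
  induction k with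
  | zero => exact ⟨x 0, rfl, by simp [orbAction]⟩
  | succ k ih =>
    obtain ⟨q₀, hq₀, hle⟩ := ih fun j hj => hx j (hj.trans k.lt_succ_self)
    have hm := hx k k.lt_succ_self
    rw [← hq₀] at hm
    obtain ⟨q, hq, hle'⟩ :=
      h.exists_orb_le_of_hasUpperBarrier hγ hu (h.hasUpperBarrier hγ hu k) q₀ _ hm
    refine ⟨q, hq, hle'.trans ?_⟩
    rw [Finset.sum_range_succ, hq₀]
    linarith

/-- At time `n` the comparison orbit ending at `x n` must start at `x n - m`, and its action does
not depend on the starting point. -/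
theorem orbAction_le (q₀ : ℝ) (x : ℕ → ℝ) (hx : ∀ j < n, (x j, x (j + 1)) ∈ genDomain A F) :
    u (x n - m) + orbAction F S γ n q₀ ≤
      u (x 0) + ∑ j ∈ Finset.range n, S (x j, x (j + 1)) := by
  obtain ⟨q, hq, hle⟩ := h.exists_orb_le hγ hu x n hx
  simp only [orb, hγ.iterate_eq] at hq
  rwa [← hq, add_sub_cancel_right, h.orbAction_eq hγ q₀ q]

omit hu

/-- A periodic orbit of type `(m, n)` with the same action as the orbits of a periodic graph
lies on this graph. -/
theorem eq_of_action_eq (hn : 0 < n) (q₀ : ℝ) {z : ℝ × ℝ} (hz : z ∈ A)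
    (hper : (F^[n] z).1 = z.1 + m)
    (hact : ∑ j ∈ Finset.range n, S ((F^[j] z).1, (F^[j + 1] z).1) = orbAction F S γ n q₀) :
    z.2 = γ z.1 := by
  obtain ⟨u, hu⟩ := hγ.exists_primitive
  have hd : HasDerivAt (fun y => u y + S (y, (F z).1)) (γ z.1 + -z.2) z.1 :=
    (hu z.1).add (h.gen.hasDerivAt_fst hz)
  have ho : IsOpen {y | (y, (F z).1) ∈ genDomain A F} := h.isOpen_genDomain_left _
  obtain ⟨k, rfl⟩ := Nat.exists_eq_succ_of_ne_zero hn.ne'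
  rw [Finset.sum_range_succ'] at hact
  -- Only the initial point of the chain moves. The lower bound depends on the final point alone,
  -- and the equality of actions makes it attained at `z.1`.
  have hlm : IsLocalMin (fun y => u y + S (y, (F z).1)) z.1 := by
    filter_upwards [ho.mem_nhds (mk_mem_genDomain hz)] with y hy
    have := h.orbAction_le hγ hu q₀ (fun j => if j = 0 then y else (F^[j] z).1) fun j _ => by
      rcases Nat.eq_zero_or_pos j with rfl | hj
      · simpa using hy
      · have := mk_mem_genDomain (F := F) (h.iterate_mem j hz)
        rw [← Function.iterate_succ_apply' F j z] at this
        simpa [hj.ne'] using this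
    rw [Finset.sum_range_succ'] at this
    simp only [Nat.succ_ne_zero, Nat.succ_eq_add_one, if_false, if_true, one_ne_zero,
      zero_add, hper, add_sub_cancel_right] at this
    simp only [zero_add, Function.iterate_zero, Function.iterate_one, id_eq, Nat.succ_eq_add_one]
      at this hact
    linarith
  linarith [hlm.hasDerivAt_eq_zero hd]

/-- Starting one step later permutes the action terms cyclically: periodicity of `S` identifies the
new last term with the old first one. -/
theorem map_graph (hn : 0 < n) (q : ℝ) : (F (q, γ q)).2 = γ (F (q, γ q)).1 := by
  have hper : F^[n] (F (q, γ q)) = F (q, γ q) + ((m : ℝ), 0) := by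
    rw [← Function.iterate_succ_apply, Function.iterate_succ_apply', hγ.iterate_eq,
      h.map_add_int q (γ q) m (hγ.mem q)]
  refine h.eq_of_action_eq hγ hn q (h.mapsTo (hγ.mem q)) (by rw [hper]; rfl) ?_
  simp only [← Function.iterate_succ_apply]
  have h1 := Finset.sum_range_succ' (fun j => S ((orb F γ j q).1, (orb F γ (j + 1) q).1)) n
  have h2 := Finset.sum_range_succ (fun j => S ((orb F γ j q).1, (orb F γ (j + 1) q).1)) n
  have h3 : S ((orb F γ n q).1, (orb F γ (n + 1) q).1) =
      S ((orb F γ 0 q).1, (orb F γ (0 + 1) q).1) := by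
    have hD := h.orb_mem_genDomain hγ 0 q
    rw [← h.gen.add_int _ _ m hD]
    have hn' : orb F γ n q = orb F γ 0 q + ((m : ℝ), 0) := by
      simp [orb, hγ.iterate_eq]
    congr 2
    · rw [hn']; rfl
    · rw [orb_succ, hn', orb_zero]
      have := h.map_add_int q (γ q) m (hγ.mem q)
      simp [this, orb]
  change ∑ j ∈ Finset.range n, S ((orb F γ (j + 1) q).1, (orb F γ (j + 1 + 1) q).1) = _
  rw [orbAction]
  linarith

/-- Orbits of either graph are competitors for the other, so both have the same action. -/
theorem graph_unique (hn : 0 < n) {η : ℝ → ℝ} (hη : IsPeriodicLipschitzGraph A F m n η) :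
    η = γ := by
  have key : ∀ {γ η : ℝ → ℝ}, IsPeriodicLipschitzGraph A F m n γ →
      IsPeriodicLipschitzGraph A F m n η → orbAction F S γ n 0 ≤ orbAction F S η n 0 := by
    intro γ η hγ hη
    obtain ⟨u, hu⟩ := hγ.exists_primitive
    have := h.orbAction_le hγ hu 0 (fun j => (orb F η j 0).1)
      fun j _ => h.orb_mem_genDomain hη j 0
    have hn' : (orb F η n 0).1 - m = (orb F η 0 0).1 := by simp [orb, hη.iterate_eq]
    rw [hn'] at this
    exact le_of_add_le_add_left this
  funext q
  refine h.eq_of_action_eq hγ hn 0 (hη.mem q) (by rw [hη.iterate_eq]) ?_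
  change orbAction F S η n q = _
  rw [h.orbAction_eq hη q 0]
  exact le_antisymm (key hη hγ) (key hγ hη)

end IsPositiveTwist

end

/-! ### Iterates, stationarity and smoothness -/

theorem iterate_leftInverse {A : Set (ℝ × ℝ)} {F G : ℝ × ℝ → ℝ × ℝ} (hA : MapsTo F A A)
    (hGF : ∀ z ∈ A, G (F z) = z) (k : ℕ) : ∀ z ∈ A, G^[k] (F^[k] z) = z := by
  induction k with
  | zero => exact fun z _ => rfl
  | succ k ih =>
    intro z hz
    rw [Function.iterate_succ_apply', Function.iterate_succ_apply, ih _ (hA hz), hGF z hz]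

theorem contDiffOn_iterate {A : Set (ℝ × ℝ)} {F : ℝ × ℝ → ℝ × ℝ} {r : WithTop ℕ∞}
    (hF : ContDiffOn ℝ r F A) (hA : MapsTo F A A) (k : ℕ) : ContDiffOn ℝ r F^[k] A := by
  induction k with
  | zero => exact contDiffOn_id
  | succ k ih => exact ih.comp hF hA

theorem IsGeneratingFunction.isStationary {A : Set (ℝ × ℝ)} {F : ℝ × ℝ → ℝ × ℝ}
    {S : ℝ × ℝ → ℝ} (hS : IsGeneratingFunction A F S) {z : ℤ → ℝ × ℝ} (hz : IsOrbit A F z) :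
    IsStationary (genDomain A F) S fun k => (z k).1 := by
  intro k
  refine ⟨?_, ?_⟩
  · have := mk_mem_genDomain (F := F) (hz k).1
    rwa [(hz k).2] at this
  · have h1 := hS.hasDerivAt_fst (hz k).1
    have h2 := hS.hasDerivAt_snd (hz (k - 1)).1
    rw [(hz (k - 1)).2, sub_add_cancel] at h2
    rw [(hz k).2] at h1
    rw [h1.deriv, h2.deriv, add_neg_cancel]

/-- An `(m, n)`-periodic graph is as smooth as the map when `∂_p (π_q ∘ F^n)` does not vanish
on it. -/
theorem IsPeriodicLipschitzGraph.contDiff {A : Set (ℝ × ℝ)} {F : ℝ × ℝ → ℝ × ℝ} {γ : ℝ → ℝ}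
    {m : ℤ} {n : ℕ} (hγ : IsPeriodicLipschitzGraph A F m n γ) (hA : IsOpen A)
    (hFA : MapsTo F A A) {r : WithTop ℕ∞} (hF : ContDiffOn ℝ r F A)
    (hd : ∀ q, deriv (fun p => (F^[n] (q, p)).1) (γ q) ≠ 0) : ContDiff ℝ r γ := by
  rcases eq_or_ne r 0 with rfl | hr
  · exact contDiff_zero.2 hγ.continuous
  refine contDiff_iff_contDiffAt.2 fun q => ?_
  have hφ : ContDiffAt ℝ r (fun z : ℝ × ℝ => (F^[n] z).1 - z.1) (q, γ q) :=
    (((contDiffOn_iterate hF hFA n).contDiffAt (hA.mem_nhds (hγ.mem q))).fst).sub contDiffAt_fst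
  have hval : ∀ x, (F^[n] (x, γ x)).1 - (x, γ x).1 = m := fun x => by
    simp [hγ.iterate_eq]
  have hinv : (fderiv ℝ (fun z : ℝ × ℝ => (F^[n] z).1 - z.1) (q, γ q) ∘L
      ContinuousLinearMap.inr ℝ ℝ ℝ).IsInvertible := by
    have h1 : HasDerivAt (fun p => (F^[n] (q, p)).1 - q)
        (fderiv ℝ (fun z : ℝ × ℝ => (F^[n] z).1 - z.1) (q, γ q) (0, 1)) (γ q) :=
      (hφ.differentiableAt hr).hasFDerivAt.comp_hasDerivAt (γ q)
        ((hasDerivAt_const (γ q) q).prodMk (hasDerivAt_id (γ q)))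
    have h2 := (h1.add_const q).deriv
    simp only [sub_add_cancel] at h2
    have h3 := hd q
    rw [h2] at h3
    refine ⟨ContinuousLinearEquiv.unitsEquivAut ℝ (Units.mk0 _ h3), ?_⟩
    ext
    simp
  -- The graph lies in the level set `π_q (F^n (q, p)) - q = m`; continuity of `γ` keeps it locally
  -- in the neighbourhood where that set is the implicit function.
  have hev := (((continuous_id.prodMk hγ.continuous).tendsto q).eventually
    (hφ.eventually_apply_eq_iff_implicitFunction hr hinv))
  refine (hφ.contDiffAt_implicitFunction hr hinv).congr_of_eventuallyEq ?_
  filter_upwards [hev] with x hx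
  exact (hx.1 ((hval x).trans (hval q).symm)).symm

/-! ### Calibration, minimality and absence of conjugate points -/

section

variable {A : Set (ℝ × ℝ)} {F G : ℝ × ℝ → ℝ × ℝ} {S : ℝ × ℝ → ℝ} {γ : ℝ → ℝ} {m : ℤ} {n : ℕ}

namespace IsPositiveTwist

variable (h : IsPositiveTwist A F G S) (hγ : IsPeriodicLipschitzGraph A F m n γ)
  {u : ℝ → ℝ} (hu : ∀ x, HasDerivAt u (γ x) x)
include h hγ

theorem orb_mem_graph (hn : 0 < n) (k : ℕ) (q : ℝ) :
    orb F γ k q = ((orb F γ k q).1, γ (orb F γ k q).1) := by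
  refine Prod.ext rfl ?_
  induction k with
  | zero => rfl
  | succ k ih =>
    have := h.map_graph hγ hn (orb F γ k q).1
    rwa [show ((orb F γ k q).1, γ (orb F γ k q).1) = orb F γ k q from Prod.ext rfl ih.symm,
      ← orb_succ (F := F) (γ := γ)] at this

theorem orb_one_orb (hn : 0 < n) (k : ℕ) (q : ℝ) :
    (orb F γ 1 (orb F γ k q).1).1 = (orb F γ (k + 1) q).1 := by
  rw [orb_succ k, orb_succ 0, orb_zero, ← h.orb_mem_graph hγ hn]

theorem inv_mem_graph (hn : 0 < n) (q : ℝ) : (G (q, γ q)).2 = γ (G (q, γ q)).1 := by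
  obtain ⟨k, rfl⟩ := Nat.exists_eq_succ_of_ne_zero hn.ne'
  -- Here `k = n - 1`: the preimage of a graph point is found by going almost once around the
  -- periodic orbit.
  have h1 : F (orb F γ k (q - m)) = (q, γ q) := by
    rw [← orb_succ (F := F) (γ := γ), orb, hγ.iterate_eq, sub_add_cancel]
    have := hγ.map_add_int (q - m) m
    rw [sub_add_cancel] at this
    rw [this]
  rw [← h1, h.left_inv _ (h.orb_mem hγ k _)]
  have := h.orb_mem_graph hγ hn k (q - m)
  exact congrArg Prod.snd this

theorem iterate_inv_mem_graph (hn : 0 < n) (k : ℕ) (q : ℝ) :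
    (G^[k] (q, γ q)).2 = γ (G^[k] (q, γ q)).1 := by
  induction k with
  | zero => rfl
  | succ k ih =>
    rw [Function.iterate_succ_apply', show G^[k] (q, γ q) =
      ((G^[k] (q, γ q)).1, γ (G^[k] (q, γ q)).1) from Prod.ext rfl ih]
    exact h.inv_mem_graph hγ hn _

theorem mem_graph_of_orbit (hn : 0 < n) {z : ℤ → ℝ × ℝ} (hz : IsOrbit A F z) {j : ℤ}
    (hj : z j ∈ graph γ) (k : ℤ) : z k ∈ graph γ := by
  induction k using Int.inductionOn' (b := j) with
  | zero => exact hj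
  | succ k _ ih =>
    have := h.map_graph hγ hn (z k).1
    rw [show ((z k).1, γ (z k).1) = z k from Prod.ext rfl (Eq.symm ih), (hz k).2] at this
    exact this
  | pred k _ ih =>
    have := h.inv_mem_graph hγ hn (z k).1
    have hk := (hz (k - 1)).2
    rw [sub_add_cancel] at hk
    rw [show ((z k).1, γ (z k).1) = z k from Prod.ext rfl (Eq.symm ih), ← hk,
      h.left_inv _ (hz (k - 1)).1] at this
    exact this

/-- By invariance a position determines the graph point, so injectivity of `F` passes to the circle
dynamics; commutation with the unit translation excludes a decreasing map. -/
theorem strictMono_orb_one (hn : 0 < n) : StrictMono fun q => (orb F γ 1 q).1 := by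
  have hinj : Function.Injective fun q => (orb F γ 1 q).1 := fun x y hxy => by
    have hx := h.orb_mem_graph hγ hn 1 x
    have hy := h.orb_mem_graph hγ hn 1 y
    have he : orb F γ 1 x = orb F γ 1 y := by
      rw [hx, hy]
      simp only at hxy
      rw [hxy]
    exact congrArg Prod.fst (h.injOn (hγ.mem x) (hγ.mem y) he)
  refine ((continuous_fst.comp (h.continuous_orb hγ 1)).strictMono_of_inj hinj).resolve_right
    fun hanti => ?_
  have h1 : (orb F γ 1 1).1 < (orb F γ 1 0).1 := hanti zero_lt_one
  have h2 := h.orb_add_int hγ 1 0 1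
  simp only [Int.cast_one, zero_add] at h2
  rw [h2] at h1
  simp at h1
  linarith

include hu

theorem calibration_eq (hn : 0 < n) (q q' : ℝ) :
    S (q, (orb F γ 1 q).1) + u q - u (orb F γ 1 q).1 =
      S (q', (orb F γ 1 q').1) + u q' - u (orb F γ 1 q').1 := by
  have hd : ∀ q, HasDerivAt
      (fun q => S (q, (orb F γ 1 q).1) + u q - u (orb F γ 1 q).1) 0 q := fun q => by
    rw [hasDerivAt_iff_isLittleO]
    have ho := h.isLittleO_orbAction hγ 1 q
    have h1 := (hasDerivAt_iff_isLittleO.1 (hu (orb F γ 1 q).1)).comp_tendsto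
      ((continuous_fst.comp (h.continuous_orb hγ 1)).tendsto q)
    have h2 := h1.trans_isBigO (Asymptotics.isBigO_fst_prod.trans (h.isBigO_orb hγ 1 q))
    refine ((ho.add (hasDerivAt_iff_isLittleO.1 (hu q))).sub h2).congr_left fun x => ?_
    have hg : (orb F γ 1 q).2 = γ (orb F γ 1 q).1 := congrArg Prod.snd (h.orb_mem_graph hγ hn 1 q)
    simp [orbAction, orb_zero, hg]
    ring
  exact is_const_of_deriv_eq_zero (fun x => (hd x).differentiableAt) (fun x => (hd x).deriv) q q'

/-- For fixed `Q` the one-step comparison moves the minimum in `x` onto the graph, where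
`calibration_eq` makes the value independent of the point. -/
theorem calibration_le (hn : 0 < n) (q : ℝ) {x Q : ℝ} (hx : (x, Q) ∈ genDomain A F) :
    S (q, (orb F γ 1 q).1) + u q - u (orb F γ 1 q).1 ≤ S (x, Q) + u x - u Q := by
  obtain ⟨q', hq', hle⟩ :=
    h.exists_orb_le_of_hasUpperBarrier hγ hu (h.hasUpperBarrier hγ hu 0) x Q hx
  rw [h.calibration_eq hγ hu hn q q']
  simp only [orbAction_succ, orb_zero, zero_add] at hle hq' ⊢
  simp only [orbAction, Finset.range_zero, Finset.sum_empty] at hle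
  rw [hq'] at hle ⊢
  linarith

omit hu

theorem isMinimalConfiguration (hn : 0 < n) {z : ℤ → ℝ × ℝ} (hz : IsOrbit A F z) {j : ℤ}
    (hj : z j ∈ graph γ) : IsMinimalConfiguration (genDomain A F) S fun k => (z k).1 := by
  obtain ⟨u, hu⟩ := hγ.exists_primitive
  refine ⟨h.gen.isStationary hz, fun a b hab y hcomp => ?_⟩
  obtain ⟨hya, hyb, hy⟩ := hcomp
  have key : action S a b (fun k => (z k).1) + u (z a).1 - u (z b).1 ≤
      action S a b y + u (y a) - u (y b) := by
    -- The induction moves the right end `b`, where the competitor need not agree with the orbit at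
    -- intermediate times.
    clear hyb
    induction b, hab using Int.leInduction with
    | base => simp [action]
    | succ b hab ih =>
      have hle := h.calibration_le hγ hu hn (z b).1 (hy b hab (lt_add_one b))
      have hzb : orb F γ 1 (z b).1 = z (b + 1) := by
        rw [orb_succ, orb_zero, ← (hz b).2]
        congr 1
        exact Prod.ext rfl (Eq.symm (h.mem_graph_of_orbit hγ hn hz hj b))
      rw [hzb] at hle
      have hs : ∀ w : ℤ → ℝ, action S a (b + 1) w = action S a b w + S (w b, w (b + 1)) :=
        fun w => by
          rw [action, ← Finset.insert_Ico_right_eq_Ico_add_one hab,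
            Finset.sum_insert Finset.right_notMem_Ico, add_comm, action]
      rw [hs, hs]
      have := ih fun k hk hkb => hy k hk (hkb.trans (lt_add_one b))
      linarith
  rw [hya, hyb] at key
  linarith

/-- The vertical segment above the graph cannot meet the graph after one step, since the inverse
preserves it. If it went below, `S(q, Q) + u q - u Q`, of derivative `P - γ Q`, would drop strictly
under its minimum. -/
theorem above_graph (hn : 0 < n) {q p : ℝ} (hp : (q, p) ∈ A) (hlt : γ q < p) :
    γ (F (q, p)).1 < (F (q, p)).2 := by
  obtain ⟨u, hu⟩ := hγ.exists_primitive
  have hfib : ∀ t ∈ Icc (γ q) p, (q, t) ∈ A := fun t ht =>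
    (h.ordConnected_fibre q).out (hγ.mem q) hp ht
  have hcF : ContinuousOn (fun t => F (q, t)) (Icc (γ q) p) :=
    h.contDiffOn.continuousOn.comp (by fun_prop) hfib
  have hne : ∀ t ∈ Ioc (γ q) p, (F (q, t)).2 - γ (F (q, t)).1 ≠ 0 := fun t ht he => by
    have hG := h.inv_mem_graph hγ hn (F (q, t)).1
    rw [show ((F (q, t)).1, γ (F (q, t)).1) = F (q, t) from
      Prod.ext rfl (sub_eq_zero.1 he).symm, h.left_inv _ (hfib t (Ioc_subset_Icc_self ht))] at hG
    exact ht.1.ne' hG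
  by_contra! hcon
  have hneg : ∀ t ∈ Ioc (γ q) p, (F (q, t)).2 - γ (F (q, t)).1 < 0 := fun t ht => by
    by_contra! hpos
    have hsub : Icc t p ⊆ Ioc (γ q) p := fun s hs => ⟨ht.1.trans_le hs.1, hs.2⟩
    have hc : ContinuousOn (fun t => (F (q, t)).2 - γ (F (q, t)).1) (Icc t p) :=
      (continuous_snd.sub (hγ.continuous.comp continuous_fst)).comp_continuousOn
        (hcF.mono (hsub.trans Ioc_subset_Icc_self))
    obtain ⟨s, hs, hs0⟩ := intermediate_value_Icc' ht.2 hc ⟨sub_nonpos.2 hcon, hpos⟩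
    exact hne s (hsub hs) hs0
  have hQ : (F (q, γ q)).1 < (F (q, p)).1 := (h.fst_lt_iff (hγ.mem q) hp).2 hlt
  have hex : ∀ Q ∈ Icc (F (q, γ q)).1 (F (q, p)).1, ∃ t ∈ Icc (γ q) p, (F (q, t)).1 = Q :=
    fun Q hQ => intermediate_value_Icc hlt.le (continuous_fst.comp_continuousOn hcF) hQ
  have hd : ∀ t ∈ Icc (γ q) p, HasDerivAt (fun Q => S (q, Q) + u q - u Q)
      ((F (q, t)).2 - γ (F (q, t)).1) (F (q, t)).1 := fun t ht =>
    ((h.gen.hasDerivAt_snd (hfib t ht)).add_const (u q)).sub (hu _)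
  have hanti : StrictAntiOn (fun Q => S (q, Q) + u q - u Q)
      (Icc (F (q, γ q)).1 (F (q, p)).1) := by
    refine strictAntiOn_of_deriv_neg (convex_Icc _ _) (fun Q hQ => ?_) fun Q hQ => ?_
    · obtain ⟨t, ht, rfl⟩ := hex Q hQ
      exact (hd t ht).continuousAt.continuousWithinAt
    · rw [interior_Icc] at hQ
      obtain ⟨t, ht, rfl⟩ := hex Q (Ioo_subset_Icc_self hQ)
      rw [(hd t ht).deriv]
      exact hneg t ⟨(h.fst_lt_iff (hγ.mem q) (hfib t ht)).1 hQ.1, ht.2⟩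
  have hlt' := hanti (left_mem_Icc.2 hQ.le) (right_mem_Icc.2 hQ.le) hQ
  have hle := h.calibration_le hγ hu hn q (mk_mem_genDomain (F := F) hp)
  exact absurd hlt' (not_lt.2 hle)

theorem iterate_above_graph (hn : 0 < n) {q p : ℝ} (hp : (q, p) ∈ A) (hlt : γ q < p) (k : ℕ) :
    γ (F^[k] (q, p)).1 < (F^[k] (q, p)).2 ∧ (orb F γ k q).1 ≤ (F^[k] (q, p)).1 := by
  induction k with
  | zero => exact ⟨hlt, le_rfl⟩
  | succ k ih =>
    rw [Function.iterate_succ_apply']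
    have hm : ((F^[k] (q, p)).1, (F^[k] (q, p)).2) ∈ A := h.iterate_mem k hp
    refine ⟨h.above_graph hγ hn hm ih.1, ?_⟩
    have h1 := (h.strictMono_orb_one hγ hn).monotone ih.2
    have h2 := (h.fst_lt_iff (hγ.mem _) hm).2 ih.1
    simp only [h.orb_one_orb hγ hn] at h1
    exact h1.trans h2.le

theorem exists_twist_lower_bound (x : ℝ) : ∃ c > 0, ∀ᶠ w in 𝓝 (x, γ x),
    γ w.1 ≤ w.2 → c * (w.2 - γ w.1) ≤ (F w).1 - (F (w.1, γ w.1)).1 := by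
  have hs := (h.contDiffAt (hγ.mem x)).hasStrictFDerivAt one_ne_zero
  set L := fderiv ℝ F (x, γ x)
  have hder : HasDerivAt (fun p => (F (x, p)).1) (L (0, 1)).1 (γ x) :=
    (hs.hasFDerivAt.comp_hasDerivAt (γ x)
      ((hasDerivAt_const (γ x) x).prodMk (hasDerivAt_id (γ x)))).fst
  have ho : IsOpen (fibre A x) := h.isOpen.preimage (by fun_prop)
  have hpos : 0 < (L (0, 1)).1 := by
    refine lt_of_le_of_ne ?_ ?_
    · rw [← hder.deriv, ← derivWithin_of_isOpen ho (hγ.mem x)]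
      exact (h.positive x).monotoneOn.derivWithin_nonneg
    · rw [← hder.deriv]
      exact (h.deriv_ne_zero x _ (hγ.mem x)).symm
  refine ⟨(L (0, 1)).1 / 2, half_pos hpos, ?_⟩
  have ht : Filter.Tendsto (fun w : ℝ × ℝ => (w, (w.1, γ w.1))) (𝓝 (x, γ x))
      (𝓝 ((x, γ x), (x, γ x))) := by
    have : Continuous fun w : ℝ × ℝ => (w, (w.1, γ w.1)) :=
      continuous_id.prodMk (continuous_fst.prodMk (hγ.continuous.comp continuous_fst))
    exact this.tendsto (x, γ x)
  filter_upwards [ht.eventually (hs.isLittleO.def (half_pos hpos))] with w hw hle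
  have hsub : w - (w.1, γ w.1) = (w.2 - γ w.1) • ((0 : ℝ), (1 : ℝ)) := by
    ext <;> simp
  rw [hsub, map_smul, norm_smul] at hw
  have h1 := (norm_fst_le _).trans hw
  simp [abs_of_nonneg (sub_nonneg.2 hle)] at h1
  have := (abs_le.1 h1).1
  nlinarith

/-- The inverse iterate is locally Lipschitz and preserves the graph, so it cannot turn a small
height into a relatively large one. -/
theorem exists_height_lower_bound (hn : 0 < n) (k : ℕ) (q : ℝ) : ∃ c > 0, ∀ᶠ p in 𝓝[>] (γ q),
    c * (p - γ q) ≤ (F^[k] (q, p)).2 - γ (F^[k] (q, p)).1 := by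
  obtain ⟨K, hK⟩ := hγ.lipschitz
  have hGk : ContDiffAt ℝ 1 G^[k] (orb F γ k q) :=
    (contDiffOn_iterate h.contDiffOn_inv h.mapsTo_inv k).contDiffAt
      (h.isOpen.mem_nhds (h.orb_mem hγ k q))
  obtain ⟨K', s, hs, hLip⟩ := (hGk.hasStrictFDerivAt one_ne_zero).exists_lipschitzOnWith
  have hFk : ContinuousAt F^[k] (q, γ q) :=
    (contDiffOn_iterate h.contDiffOn h.mapsTo k).continuousOn.continuousAt
      (h.isOpen.mem_nhds (hγ.mem q))
  have ht1 : Filter.Tendsto (fun p => F^[k] (q, p)) (𝓝[>] (γ q)) (𝓝 (orb F γ k q)) :=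
    (hFk.tendsto.comp ((by fun_prop : Continuous fun p : ℝ => (q, p)).tendsto (γ q))).mono_left
      nhdsWithin_le_nhds
  have ht2 : Filter.Tendsto (fun p => ((F^[k] (q, p)).1, γ (F^[k] (q, p)).1)) (𝓝[>] (γ q))
      (𝓝 (orb F γ k q)) := by
    have := ((continuous_fst.prodMk (hγ.continuous.comp continuous_fst)).tendsto
      (orb F γ k q)).comp ht1
    rwa [Function.comp_apply, ← h.orb_mem_graph hγ hn k q] at this
  have hinv : ∀ p, (q, p) ∈ A → G^[k] (F^[k] (q, p)) = (q, p) := fun p hp =>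
    iterate_leftInverse h.mapsTo h.left_inv k _ hp
  have hA : ∀ᶠ p in 𝓝[>] (γ q), (q, p) ∈ A :=
    nhdsWithin_le_nhds (((by fun_prop : Continuous fun p : ℝ => (q, p)).tendsto (γ q)).eventually
      (h.isOpen.mem_nhds (hγ.mem q)))
  have hpos : (0 : ℝ) < (1 + K) * (K' + 1) := by positivity
  -- Pulling back a height `H` gives `p - γ q ≤ (1 + K) K' H`: one part is vertical error, the other
  -- comes from the slope of `γ`. The `+ 1` keeps the constant invertible.
  refine ⟨((1 + K) * (K' + 1))⁻¹, inv_pos.2 hpos, ?_⟩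
  filter_upwards [ht1.eventually hs, ht2.eventually hs, hA, self_mem_nhdsWithin] with p h1 h2 hp hlt
  have hgt := (h.iterate_above_graph hγ hn hp hlt k).1
  set w := F^[k] (q, p) with hw
  have hdist := hLip.dist_le_mul w h1 (w.1, γ w.1) h2
  have hw' : dist w (w.1, γ w.1) = w.2 - γ w.1 := by
    rw [Prod.dist_eq, dist_self, Real.dist_eq, abs_of_pos (sub_pos.2 hgt)]
    exact max_eq_right (sub_pos.2 hgt).le
  rw [hw, hinv p hp, ← hw, hw'] at hdist
  have hG := h.iterate_inv_mem_graph hγ hn k w.1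
  set v := G^[k] (w.1, γ w.1)
  have hd1 : |q - v.1| ≤ K' * (w.2 - γ w.1) := (le_max_left _ _).trans hdist
  have hd2 : |p - v.2| ≤ K' * (w.2 - γ w.1) := (le_max_right _ _).trans hdist
  have hd3 : |γ v.1 - γ q| ≤ K * |v.1 - q| := by
    simpa [Real.dist_eq] using hK.dist_le_mul v.1 q
  rw [abs_sub_comm v.1] at hd3
  rw [hG] at hd2
  have h4 : p - γ q ≤ (1 + K) * (K' * (w.2 - γ w.1)) := by
    have := mul_le_mul_of_nonneg_left hd1 K.coe_nonneg
    linarith [le_abs_self (p - γ v.1), le_abs_self (γ v.1 - γ q)]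
  rw [inv_mul_le_iff₀ hpos]
  have h5 : 0 ≤ (1 + (K : ℝ)) * (w.2 - γ w.1) :=
    mul_nonneg (by positivity) (sub_pos.2 hgt).le
  linarith

/-- The first `k` steps preserve a definite fraction `c'` of the height and do not fall behind the
graph orbit; the last step converts height into horizontal advance at rate `c`. Hence right slopes
are at least `c * c'`. -/
theorem deriv_iterate_pos (hn : 0 < n) (k : ℕ) (q : ℝ) :
    0 < deriv (fun p => (F^[k + 1] (q, p)).1) (γ q) := by
  have hdiff : DifferentiableAt ℝ (fun p => (F^[k + 1] (q, p)).1) (γ q) := by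
    have := ((contDiffOn_iterate h.contDiffOn h.mapsTo (k + 1)).contDiffAt
      (h.isOpen.mem_nhds (hγ.mem q))).differentiableAt one_ne_zero
    exact (this.comp (γ q) (by fun_prop)).fst
  obtain ⟨c, hc, hcw⟩ := h.exists_twist_lower_bound hγ (orb F γ k q).1
  obtain ⟨c', hc', hcp⟩ := h.exists_height_lower_bound hγ hn k q
  rw [← h.orb_mem_graph hγ hn] at hcw
  have hFk : ContinuousAt F^[k] (q, γ q) :=
    (contDiffOn_iterate h.contDiffOn h.mapsTo k).continuousOn.continuousAt
      (h.isOpen.mem_nhds (hγ.mem q))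
  have ht1 : Filter.Tendsto (fun p => F^[k] (q, p)) (𝓝[>] (γ q)) (𝓝 (orb F γ k q)) :=
    (hFk.tendsto.comp ((by fun_prop : Continuous fun p : ℝ => (q, p)).tendsto (γ q))).mono_left
      nhdsWithin_le_nhds
  have hA : ∀ᶠ p in 𝓝[>] (γ q), (q, p) ∈ A :=
    nhdsWithin_le_nhds (((by fun_prop : Continuous fun p : ℝ => (q, p)).tendsto (γ q)).eventually
      (h.isOpen.mem_nhds (hγ.mem q)))
  have hslope : ∀ᶠ p in 𝓝[>] (γ q), c * c' ≤ slope (fun p => (F^[k + 1] (q, p)).1) (γ q) p := by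
    filter_upwards [ht1.eventually hcw, hcp, hA, self_mem_nhdsWithin] with p h1 h2 hp hlt
    obtain ⟨hgt, hle⟩ := h.iterate_above_graph hγ hn hp hlt k
    have h3 := h1 hgt.le
    have h4 := (h.strictMono_orb_one hγ hn).monotone hle
    simp only [h.orb_one_orb hγ hn] at h4
    rw [slope_def_field, le_div_iff₀ (sub_pos.2 hlt), Function.iterate_succ_apply']
    have h5 := mul_le_mul_of_nonneg_left h2 hc.le
    have h6 : (orb F γ 1 (F^[k] (q, p)).1).1 =
      (F ((F^[k] (q, p)).1, γ (F^[k] (q, p)).1)).1 := rfl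
    have h7 : (F^[k + 1] (q, γ q)).1 = (orb F γ (k + 1) q).1 := rfl
    rw [h7]
    linarith
  exact (mul_pos hc hc').trans_le (ge_of_tendsto
    ((hasDerivAt_iff_tendsto_slope.1 hdiff.hasDerivAt).mono_left
      (nhdsWithin_mono (s := Ioi (γ q)) _ fun y hy => ne_of_gt hy)) hslope)

end IsPositiveTwist

end

/-! ### Reflection and reduction of negative twists -/

/-- The reflection `(q, p) ↦ (q, -p)`, which exchanges positive and negative twist maps. -/
def reflect (z : ℝ × ℝ) : ℝ × ℝ := (z.1, -z.2)

theorem reflect_reflect (z : ℝ × ℝ) : reflect (reflect z) = z := by simp [reflect]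

theorem contDiff_reflect : ContDiff ℝ 1 reflect := contDiff_fst.prodMk contDiff_snd.neg

theorem iterate_reflect (F : ℝ × ℝ → ℝ × ℝ) (k : ℕ) (z : ℝ × ℝ) :
    (fun z => reflect (F (reflect z)))^[k] z = reflect (F^[k] (reflect z)) := by
  induction k with
  | zero => exact (reflect_reflect z).symm
  | succ k ih => rw [Function.iterate_succ_apply', ih, reflect_reflect, Function.iterate_succ_apply']

section

variable {A : Set (ℝ × ℝ)} {F G : ℝ × ℝ → ℝ × ℝ} {S : ℝ × ℝ → ℝ} {γ : ℝ → ℝ} {m : ℤ} {n : ℕ}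

theorem genDomain_reflect :
    genDomain (reflect ⁻¹' A) (fun z => reflect (F (reflect z))) = genDomain A F := by
  ext ⟨q, Q⟩
  constructor
  · rintro ⟨z, hz, he⟩
    exact ⟨reflect z, hz, he⟩
  · rintro ⟨z, hz, he⟩
    refine ⟨reflect z, ?_, ?_⟩
    · simpa [reflect_reflect] using hz
    · simp only [reflect_reflect]
      exact he

theorem IsGeneratingFunction.reflect (hS : IsGeneratingFunction A F S) :
    IsGeneratingFunction (reflect ⁻¹' A) (fun z => reflect (F (reflect z))) (fun z => -S z) where
  isOpen_domain := by rw [genDomain_reflect]; exact hS.isOpen_domain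
  contDiffOn := by rw [genDomain_reflect]; exact hS.contDiffOn.neg
  domain_add_int := by rw [genDomain_reflect]; exact hS.domain_add_int
  add_int q Q l hq := by
    rw [genDomain_reflect] at hq
    rw [hS.add_int q Q l hq]
  hasFDerivAt z hz := by
    refine (hS.hasFDerivAt _ hz).neg.congr_fderiv ?_
    ext <;> simp [TwistMap.reflect]

theorem IsPeriodicLipschitzGraph.reflect (hγ : IsPeriodicLipschitzGraph A F m n γ) :
    IsPeriodicLipschitzGraph (reflect ⁻¹' A) (fun z => reflect (F (reflect z))) m n (-γ) where
  lipschitz := by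
    obtain ⟨K, hK⟩ := hγ.lipschitz
    refine ⟨K, LipschitzWith.of_dist_le_mul fun x y => ?_⟩
    simpa using hK.dist_le_mul x y
  periodic x := by simp [hγ.periodic x]
  graph_subset z hz := hγ.graph_subset (show -z.2 = γ z.1 by
    rw [show z.2 = -γ z.1 from hz, neg_neg])
  iterate_eq q := by
    rw [iterate_reflect]
    simp [TwistMap.reflect, hγ.iterate_eq]

theorem IsTwist.reflect (h : IsTwist A F G S) :
    IsTwist (reflect ⁻¹' A) (fun z => reflect (F (reflect z))) (fun z => reflect (G (reflect z)))
      (fun z => -S z) where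
  isOpen := h.isOpen.preimage contDiff_reflect.continuous
  ordConnected_fibre q := by
    refine ⟨fun x hx y hy t ht => ?_⟩
    exact (h.ordConnected_fibre q).out hy hx ⟨neg_le_neg ht.2, neg_le_neg ht.1⟩
  mapsTo z hz := by
    simpa [reflect_reflect] using h.mapsTo hz
  mapsTo_inv z hz := by
    simpa [reflect_reflect] using h.mapsTo_inv hz
  left_inv z hz := by
    simp only [reflect_reflect]
    rw [h.left_inv _ hz, reflect_reflect]
  right_inv z hz := by
    simp only [reflect_reflect]
    rw [h.right_inv _ hz, reflect_reflect]
  contDiffOn := contDiff_reflect.comp_contDiffOn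
    (h.contDiffOn.comp contDiff_reflect.contDiffOn fun _ hz => hz)
  contDiffOn_inv := contDiff_reflect.comp_contDiffOn
    (h.contDiffOn_inv.comp contDiff_reflect.contDiffOn fun _ hz => hz)
  map_add_int q p l hp := by
    have := h.map_add_int q (-p) l hp
    simp [TwistMap.reflect, this]
  gen := h.gen.reflect
  deriv_ne_zero q p hp := by
    have := h.deriv_ne_zero q (-p) hp
    simpa [TwistMap.reflect, deriv_comp_neg (fun p => (F (q, p)).1)] using this

theorem IsTwist.positive_reflect (h : IsTwist A F G S) (hneg : IsNegative A F) :
    IsPositiveTwist (TwistMap.reflect ⁻¹' A) (fun z => TwistMap.reflect (F (TwistMap.reflect z)))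
      (fun z => TwistMap.reflect (G (TwistMap.reflect z))) (fun z => -S z) where
  toIsTwist := h.reflect
  positive q _ hp _ hp' hlt := hneg q hp' hp (neg_lt_neg hlt)

namespace IsTwist

variable (h : IsTwist A F G S) (hγ : IsPeriodicLipschitzGraph A F m n γ)
include h

theorem hasDerivAt_fst_map {q p : ℝ} (hp : (q, p) ∈ A) :
    HasDerivAt (fun p => (F (q, p)).1) (fderiv ℝ F (q, p) (0, 1)).1 p :=
  (((h.contDiffOn.contDiffAt (h.isOpen.mem_nhds hp)).differentiableAt
    one_ne_zero).hasFDerivAt.comp_hasDerivAt p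
      ((hasDerivAt_const p q).prodMk (hasDerivAt_id p))).fst

theorem continuousOn_deriv_fst_map : ContinuousOn (fun z => (fderiv ℝ F z (0, 1)).1) A :=
  continuous_fst.comp_continuousOn
    ((h.contDiffOn.continuousOn_fderiv_of_isOpen h.isOpen le_rfl).clm_apply continuousOn_const)

theorem deriv_fst_map_ne_zero {z : ℝ × ℝ} (hz : z ∈ A) : (fderiv ℝ F z (0, 1)).1 ≠ 0 := by
  rw [← (h.hasDerivAt_fst_map (q := z.1) (p := z.2) hz).deriv]
  exact h.deriv_ne_zero _ _ hz

include hγ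

/-- The graph meets every fibre and links them all; this forces one sign of the twist derivative on
the whole domain. -/
theorem isPreconnected_domain : IsPreconnected A := by
  have hg : IsPreconnected (range fun q => (q, γ q)) :=
    isPreconnected_range (continuous_id.prodMk hγ.continuous)
  refine isPreconnected_of_forall (0, γ 0) fun z hz => ?_
  refine ⟨(range fun q => (q, γ q)) ∪ Prod.mk z.1 '' fibre A z.1, ?_, ?_, ?_, ?_⟩
  · rintro w (⟨q, rfl⟩ | ⟨p, hp, rfl⟩)
    · exact hγ.mem q
    · exact hp
  · exact Or.inl ⟨0, rfl⟩
  · exact Or.inr ⟨z.2, hz, rfl⟩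
  · exact hg.union (z.1, γ z.1) ⟨z.1, rfl⟩ ⟨γ z.1, hγ.mem z.1, rfl⟩
      ((h.ordConnected_fibre z.1).isPreconnected.image _ (by fun_prop))

theorem positive_or_negative : IsPositive A F ∨ IsNegative A F := by
  have hcont : ∀ q, ContinuousOn (fun p => (F (q, p)).1) (fibre A q) := fun q p hp =>
    (h.hasDerivAt_fst_map hp).continuousAt.continuousWithinAt
  have hsign : (∀ z ∈ A, 0 < (fderiv ℝ F z (0, 1)).1) ∨
      ∀ z ∈ A, (fderiv ℝ F z (0, 1)).1 < 0 := by
    by_contra! hcon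
    obtain ⟨⟨z, hz, hz0⟩, w, hw, hw0⟩ := hcon
    obtain ⟨v, hv, hv0⟩ := (h.isPreconnected_domain hγ).intermediate_value hz hw
      h.continuousOn_deriv_fst_map ⟨hz0, hw0⟩
    exact h.deriv_fst_map_ne_zero hv hv0
  rcases hsign with hs | hs
  · refine Or.inl fun q => strictMonoOn_of_deriv_pos (h.ordConnected_fibre q).convex (hcont q)
      fun p hp => ?_
    have hpA : (q, p) ∈ A := interior_subset (s := fibre A q) hp
    rw [(h.hasDerivAt_fst_map hpA).deriv]
    exact hs _ hpA
  · refine Or.inr fun q => strictAntiOn_of_deriv_neg (h.ordConnected_fibre q).convex (hcont q)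
      fun p hp => ?_
    have hpA : (q, p) ∈ A := interior_subset (s := fibre A q) hp
    rw [(h.hasDerivAt_fst_map hpA).deriv]
    exact hs _ hpA

theorem map_graph (hn : 0 < n) (q : ℝ) : (F (q, γ q)).2 = γ (F (q, γ q)).1 := by
  rcases h.positive_or_negative hγ with hp | hneg
  · exact IsPositiveTwist.map_graph ⟨h, hp⟩ hγ hn q
  · have := (h.positive_reflect hneg).map_graph hγ.reflect hn q
    simpa [TwistMap.reflect] using this

theorem graph_unique (hn : 0 < n) {η : ℝ → ℝ} (hη : IsPeriodicLipschitzGraph A F m n η) :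
    η = γ := by
  rcases h.positive_or_negative hγ with hp | hneg
  · exact IsPositiveTwist.graph_unique ⟨h, hp⟩ hγ hn hη
  · exact neg_injective ((h.positive_reflect hneg).graph_unique hγ.reflect hn hη.reflect)

theorem deriv_iterate_ne_zero (hn : 0 < n) (k : ℕ) (q : ℝ) :
    deriv (fun p => (F^[k + 1] (q, p)).1) (γ q) ≠ 0 := by
  rcases h.positive_or_negative hγ with hp | hneg
  · exact (IsPositiveTwist.deriv_iterate_pos ⟨h, hp⟩ hγ hn k q).ne'
  · have := (h.positive_reflect hneg).deriv_iterate_pos hγ.reflect hn k q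
    simp only [iterate_reflect] at this
    simp only [TwistMap.reflect, Pi.neg_apply, deriv_comp_neg (fun p => (F^[k + 1] (q, p)).1),
      neg_neg] at this
    exact (neg_pos.1 this).ne

theorem mem_graph_of_orbit (hn : 0 < n) {z : ℤ → ℝ × ℝ} (hz : IsOrbit A F z) {j : ℤ}
    (hj : z j ∈ graph γ) (k : ℤ) : z k ∈ graph γ := by
  rcases h.positive_or_negative hγ with hp | hneg
  · exact IsPositiveTwist.mem_graph_of_orbit ⟨h, hp⟩ hγ hn hz hj k
  · have := (h.positive_reflect hneg).mem_graph_of_orbit hγ.reflect hn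
      (z := fun k => TwistMap.reflect (z k)) (j := j)
      (fun k => ⟨by simpa [reflect_reflect] using (hz k).1, by simp [reflect_reflect, (hz k).2]⟩)
      (congrArg Neg.neg hj) k
    exact neg_injective this

theorem isMaximalConfiguration (hneg : IsNegative A F) (hn : 0 < n) {z : ℤ → ℝ × ℝ}
    (hz : IsOrbit A F z) {j : ℤ} (hj : z j ∈ graph γ) :
    IsMaximalConfiguration (genDomain A F) S fun k => (z k).1 := by
  refine ⟨h.gen.isStationary hz, fun a b hab y hy => ?_⟩
  have := ((h.positive_reflect hneg).isMinimalConfiguration hγ.reflect hn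
    (z := fun k => TwistMap.reflect (z k)) (j := j)
    (fun k => ⟨by simpa [reflect_reflect] using (hz k).1, by simp [reflect_reflect, (hz k).2]⟩)
    (congrArg Neg.neg hj)).2 a b hab y (by rw [genDomain_reflect]; exact hy)
  simp only [action, Finset.sum_neg_distrib, neg_le_neg_iff] at this
  exact this

omit hγ

/-- If the inverse differential kept the vertical direction, so would the forward one, contradicting
`hd`. -/
theorem deriv_iterate_inv_ne_zero (k : ℕ) {z : ℝ × ℝ} (hz : z ∈ A)
    (hd : deriv (fun p => (F^[k] (z.1, p)).1) z.2 ≠ 0) :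
    deriv (fun p => (G^[k] ((F^[k] z).1, p)).1) (F^[k] z).2 ≠ 0 := by
  have hG := iterate_leftInverse h.mapsTo h.left_inv
  have hF := iterate_leftInverse h.mapsTo_inv h.right_inv
  have hw : F^[k] z ∈ A := h.mapsTo.iterate k hz
  have hdF : HasFDerivAt F^[k] (fderiv ℝ F^[k] z) z :=
    (((contDiffOn_iterate h.contDiffOn h.mapsTo k).contDiffAt
      (h.isOpen.mem_nhds hz)).differentiableAt one_ne_zero).hasFDerivAt
  have hdG : HasFDerivAt G^[k] (fderiv ℝ G^[k] (F^[k] z)) (F^[k] z) :=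
    (((contDiffOn_iterate h.contDiffOn_inv h.mapsTo_inv k).contDiffAt
      (h.isOpen.mem_nhds hw)).differentiableAt one_ne_zero).hasFDerivAt
  set L := fderiv ℝ F^[k] z
  set N := fderiv ℝ G^[k] (F^[k] z)
  have h1 : HasDerivAt (fun p => (F^[k] (z.1, p)).1) (L (0, 1)).1 z.2 :=
    (HasFDerivAt.comp_hasDerivAt (l := F^[k]) z.2 hdF
      ((hasDerivAt_const z.2 z.1).prodMk (hasDerivAt_id z.2))).fst
  have h2 : HasDerivAt (fun p => (G^[k] ((F^[k] z).1, p)).1) (N (0, 1)).1 (F^[k] z).2 :=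
    (HasFDerivAt.comp_hasDerivAt (l := G^[k]) (F^[k] z).2 hdG
      ((hasDerivAt_const _ (F^[k] z).1).prodMk (hasDerivAt_id (F^[k] z).2))).fst
  rw [h1.deriv] at hd
  rw [h2.deriv]
  intro h0
  have hcomp : HasFDerivAt (F^[k] ∘ G^[k]) (L ∘L N) (F^[k] z) :=
    HasFDerivAt.comp _ (by rwa [hG k z hz]) hdG
  have hid : HasFDerivAt (F^[k] ∘ G^[k]) (ContinuousLinearMap.id ℝ (ℝ × ℝ)) (F^[k] z) := by
    refine (hasFDerivAt_id _).congr_of_eventuallyEq ?_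
    filter_upwards [h.isOpen.mem_nhds hw] with w hw using hF k w hw
  have hLN := congrArg (fun T : ℝ × ℝ →L[ℝ] ℝ × ℝ => T (0, 1)) (hcomp.unique hid)
  have hN : N (0, 1) = (N (0, 1)).2 • ((0 : ℝ), (1 : ℝ)) := by
    ext <;> simp [h0]
  simp only [ContinuousLinearMap.comp_apply, ContinuousLinearMap.id_apply] at hLN
  rw [hN, map_smul] at hLN
  have e1 := congrArg Prod.fst hLN
  have e2 := congrArg Prod.snd hLN
  simp only [Prod.smul_fst, Prod.smul_snd, smul_eq_mul, mul_eq_zero] at e1 e2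
  rcases e1 with e1 | e1
  · simp [e1] at e2
  · exact hd e1

end IsTwist

end

/-! ### Application to strips and two-sided orbits -/

theorem IsExactSymplecticTwistMap.isTwist {pm pp : ℝ → EReal}
    {F : OpenPartialHomeomorph (ℝ × ℝ) (ℝ × ℝ)} (hF : IsExactSymplecticTwistMap pm pp F)
    {S : ℝ × ℝ → ℝ} (hS : IsGeneratingFunction (strip pm pp) F S) :
    IsTwist (strip pm pp) F F.symm S where
  isOpen := hF.source_eq ▸ F.open_source
  ordConnected_fibre q := ⟨fun x hx y hy t ht =>
    ⟨hx.1.trans_le (EReal.coe_le_coe_iff.2 ht.1), (EReal.coe_le_coe_iff.2 ht.2).trans_lt hy.2⟩⟩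
  mapsTo z hz := by
    rw [← hF.source_eq] at hz
    exact hF.target_eq ▸ F.map_source hz
  mapsTo_inv z hz := by
    rw [← hF.target_eq] at hz
    exact hF.source_eq ▸ F.map_target hz
  left_inv z hz := F.left_inv (hF.source_eq.symm ▸ hz)
  right_inv z hz := F.right_inv (hF.target_eq.symm ▸ hz)
  contDiffOn := hF.contDiffOn
  contDiffOn_inv := hF.contDiffOn_symm
  map_add_int := hF.map_add_int
  gen := hS
  deriv_ne_zero := hF.twist_deriv_ne_zero

theorem IsOrbit.iterate_eq {A : Set (ℝ × ℝ)} {F : ℝ × ℝ → ℝ × ℝ} {z : ℤ → ℝ × ℝ}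
    (hz : IsOrbit A F z) (k : ℤ) (j : ℕ) : F^[j] (z k) = z (k + j) := by
  induction j with
  | zero => simp
  | succ j ih =>
    rw [Function.iterate_succ_apply', ih, (hz _).2]
    push_cast
    rw [add_assoc]

theorem IsTwist.hasNoConjugatePoints {A : Set (ℝ × ℝ)}
    {F : OpenPartialHomeomorph (ℝ × ℝ) (ℝ × ℝ)} {S : ℝ × ℝ → ℝ} {γ : ℝ → ℝ} {m : ℤ} {n : ℕ}
    (h : IsTwist A F F.symm S) (hγ : IsPeriodicLipschitzGraph A F m n γ) (hn : 0 < n)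
    {z : ℤ → ℝ × ℝ} (hz : IsOrbit A F z) (hg : ∀ k, z k ∈ graph γ) :
    HasNoConjugatePoints F z := by
  intro k l hkl
  have hd : ∀ (j : ℕ) (k : ℤ), deriv (fun p => (F^[j + 1] ((z k).1, p)).1) (z k).2 ≠ 0 :=
    fun j k => by
      rw [show (z k).2 = γ (z k).1 from hg k]
      exact h.deriv_iterate_ne_zero hγ hn j _
  rcases hj : l - k with j | j
  · obtain ⟨j, rfl⟩ := Nat.exists_eq_succ_of_ne_zero (n := j) (by
      rintro rfl
      simp only [Int.ofNat_eq_natCast, Nat.cast_zero] at hj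
      omega)
    exact hd j k
  -- For negative time `-(j + 1)`, `z k` is the forward iterate of `z l`, so the inverse lemma
  -- applies based at `z l`.
  · have hk := hz.iterate_eq l (j + 1)
    rw [show l + ((j + 1 : ℕ) : ℤ) = k by omega] at hk
    have := h.deriv_iterate_inv_ne_zero (j + 1) (hz l).1 (hd j l)
    rwa [hk] at this

end TwistMap

theorem proposition21 (pm pp : ℝ → EReal) (F : OpenPartialHomeomorph (ℝ × ℝ) (ℝ × ℝ))
    (hF : TwistMap.IsExactSymplecticTwistMap pm pp F)
    (m : ℤ) (n : ℕ) (hn : 0 < n) (hmn : IsCoprime m (n : ℤ)) (γ : ℝ → ℝ)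
    (hγ : TwistMap.IsPeriodicLipschitzGraph (TwistMap.strip pm pp) F m n γ) :
    -- (i) the graph is invariant
    F '' TwistMap.graph γ ⊆ TwistMap.graph γ ∧
    -- (ii) orbits meeting the graph are minimal (maximal for negative twist) ...
    (∀ z : ℤ → ℝ × ℝ, TwistMap.IsOrbit (TwistMap.strip pm pp) F z →
      (∃ j : ℤ, z j ∈ TwistMap.graph γ) →
      (∀ S : ℝ × ℝ → ℝ, TwistMap.IsGeneratingFunction (TwistMap.strip pm pp) F S →
        (TwistMap.IsPositive (TwistMap.strip pm pp) F →
          TwistMap.IsMinimalConfiguration (TwistMap.genDomain (TwistMap.strip pm pp) F) S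
            (fun k => (z k).1)) ∧
        (TwistMap.IsNegative (TwistMap.strip pm pp) F →
          TwistMap.IsMaximalConfiguration (TwistMap.genDomain (TwistMap.strip pm pp) F) S
            (fun k => (z k).1))) ∧
      -- ... and have no conjugate points
      TwistMap.HasNoConjugatePoints F z) ∧
    -- (iii) the graph is as smooth as the map; the exponent `ω` is analyticity
    (∀ r : WithTop ℕ∞, ContDiffOn ℝ r F (TwistMap.strip pm pp) → ContDiff ℝ r γ) ∧
    -- (iv) uniqueness
    (∀ η : ℝ → ℝ, TwistMap.IsPeriodicLipschitzGraph (TwistMap.strip pm pp) F m n η → η = γ) := by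
  obtain ⟨S₀, hS₀⟩ := hF.exists_generatingFunction
  have h := hF.isTwist hS₀
  refine ⟨?_, ?_, ?_, fun η hη => h.graph_unique hγ hn hη⟩
  · rintro _ ⟨⟨q, p⟩, hp, rfl⟩
    obtain rfl : p = γ q := hp
    exact h.map_graph hγ hn q
  · rintro z hz ⟨j, hj⟩
    refine ⟨fun S hS => ⟨fun hpos => ?_, fun hneg => ?_⟩, ?_⟩
    · exact TwistMap.IsPositiveTwist.isMinimalConfiguration ⟨hF.isTwist hS, hpos⟩ hγ hn hz hj
    · exact (hF.isTwist hS).isMaximalConfiguration hγ hneg hn hz hj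
    · exact h.hasNoConjugatePoints hγ hn hz (h.mem_graph_of_orbit hγ hn hz hj)
  · intro r hr
    obtain ⟨k, rfl⟩ := Nat.exists_eq_succ_of_ne_zero hn.ne'
    exact hγ.contDiff h.isOpen h.mapsTo hr (h.deriv_iterate_ne_zero hγ hn k)
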